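/- Let $d$ and $k$ be integers with $0\le k<d$. Write the elements of $\mathbb{R}^{(k+1)(d-k)}$ as $y=(y_i^j)$ with $i=0,\dots,k$ and $j=1,\dots,d-k$, and let $\pi_y\subset\mathbb{R}^d$ be the affine $k$-plane $$\pi_y=\Big\{\big(x_1,\dots,x_k,\;y_0^1+\sum_{i=1}^k x_i y_i^1,\;\dots,\;y_0^{d-k}+\sum_{i=1}^k x_i y_i^{d-k}\big):\ (x_1,\dots,x_k)\in\mathbb{R}^k\Big\}.$$ Suppose that $S\subset\mathbb{R}^{(k+1)(d-k)}$ is a compact set whose Hausdorff dimension (for the Euclidean metric) is strictly greater than $(k+1)(d-k)-k$. Then $\bigcup_{y\in S}\pi_y$ is a Borel set of positive Lebesgue measure in $\mathbb{R}^d$. -/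

import Mathlib

open MeasureTheory
open scoped ENNReal

noncomputable section

/-- The parameter space `ℝ^{(k+1)(d-k)}` with its Euclidean metric.  The coordinate `y (i, j)`
is the entry `y_i^j`, with `i = 0, …, k`; the upper index is numbered `j = 0, …, d-k-1`. -/
abbrev PlaneParam (d k : ℕ) : Type :=
  EuclideanSpace ℝ (Fin (k + 1) × Fin (d - k))

/-- The point `(x_1, …, x_k, y_0^1 + ∑ x_i y_i^1, …, y_0^{d-k} + ∑ x_i y_i^{d-k})` of `ℝ^d`. -/
def planePoint {d k : ℕ} (y : PlaneParam d k) (x : Fin k → ℝ) : EuclideanSpace ℝ (Fin d) :=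
  WithLp.toLp 2 fun m =>
    if h : (m : ℕ) < k then x ⟨m, h⟩
    else
      y (0, ⟨m - k, by omega⟩) + ∑ i : Fin k, x i * y (i.succ, ⟨m - k, by omega⟩)

/-- The affine `k`-plane `π_y` in `ℝ^d` with parameter `y`. -/
def kPlane {d k : ℕ} (y : PlaneParam d k) : Set (EuclideanSpace ℝ (Fin d)) :=
  Set.range (planePoint y)

end

/-! Put n = (k+1)(d-k), m = d-k, and fix s with n-k < s < dim S. A Frostman measure μ on S satisfies
μ(B(y,r)) ≲ r^s. Above x the union of the planes contains the points `slicePoint x y`, y ∈ S, and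
the push-forward of μ under y ↦ `slicePoint x y` has Fourier transform ξ ↦ μ̂(`dualPoint x ξ`), with
`dualPoint x ξ` = (ξ, x_1 ξ, …, x_k ξ). It suffices to bound the integral of |μ̂(`dualPoint x ξ`)|²
over ξ and over x with a Gaussian weight: the push-forwards then have square-integrable densities on
average, and a second moment argument gives the union positive measure.

As μ has bounded support, |μ̂|² is dominated by its unit-scale averages, after replacing μ by a
comparable measure (`norm_trigSum_sq_le_lintegral`). Smearing the image of dx dξ at unit scale
produces a density of size about (1+|η|)^(-k): for given ξ and η, completing the square shows a
Gaussian of width (1+|ξ|²)^(-1/2) in each of the k variables x_i, and only |ξ| ≳ |η| contributes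
substantially (`lintegral_kernel_le`). Hence the integral is controlled by the (n-k)-energy of μ, in
dyadic form ∑ 2^(j(n-k-s)), which converges (`exists_sliceEnergy_le`).

Everything is carried out with finite sums of point masses at resolution 2⁻ᴺ
(`exists_frostman_weights`), with bounds uniform in N. The second moment of a sum of tubes of width
2⁻ᴺ is at most a constant times the energy (`mass_le_volume_cthickening_add_sliceEnergy`), and
compactness of S allows N → ∞ (`volume_sliceUnion_pos`). -/

open scoped RealInnerProductSpace

/-! ### Exponential sums and their Gaussian averages. -/

section TrigSum

variable {ι V : Type*} [Fintype ι] [NormedAddCommGroup V] [InnerProductSpace ℝ V]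

/-- The exponential sum `∑ w_a e(⟨y_a, ξ⟩)`, the Fourier transform of `∑ w_a δ_{y_a}` (up to
reflection). -/
noncomputable def trigSum (w : ι → ℝ) (y : ι → V) (ξ : V) : ℂ :=
  ∑ a, (w a : ℂ) * Complex.exp (2 * Real.pi * Complex.I * (⟪y a, ξ⟫ : ℝ))

@[fun_prop]
lemma continuous_trigSum (w : ι → ℝ) (y : ι → V) : Continuous (trigSum w y) := by
  unfold trigSum; fun_prop

lemma norm_exp_two_pi_I (t : ℝ) : ‖Complex.exp (2 * Real.pi * Complex.I * (t : ℝ))‖ = 1 := by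
  have : (2 * Real.pi * Complex.I * (t : ℝ) : ℂ) = ((2 * Real.pi * t : ℝ) : ℂ) * Complex.I := by
    push_cast; ring
  rw [this, Complex.norm_exp_ofReal_mul_I]

lemma norm_trigSum_le (w : ι → ℝ) (y : ι → V) (ξ : V) : ‖trigSum w y ξ‖ ≤ ∑ a, |w a| := by
  refine (norm_sum_le _ _).trans (Finset.sum_le_sum fun a _ => ?_)
  rw [norm_mul, norm_exp_two_pi_I, mul_one, Complex.norm_real, Real.norm_eq_abs]

lemma norm_trigSum_sq (w : ι → ℝ) (y : ι → V) (ξ : V) :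
    ((‖trigSum w y ξ‖ ^ 2 : ℝ) : ℂ) = ∑ a, ∑ b, ((w a * w b : ℝ) : ℂ) *
      Complex.exp (2 * Real.pi * Complex.I * (⟪y a - y b, ξ⟫ : ℝ)) := by
  have h : ((‖trigSum w y ξ‖ ^ 2 : ℝ) : ℂ)
      = trigSum w y ξ * (starRingEnd ℂ) (trigSum w y ξ) := by
    rw [Complex.mul_conj, Complex.normSq_eq_norm_sq]
  rw [h, trigSum, map_sum, Finset.sum_mul_sum]
  refine Finset.sum_congr rfl fun a _ => Finset.sum_congr rfl fun b _ => ?_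
  rw [map_mul, Complex.conj_ofReal, ← Complex.exp_conj, mul_mul_mul_comm, ← Complex.exp_add,
    Complex.ofReal_mul, inner_sub_left]
  congr 2
  simp only [map_mul, Complex.conj_ofReal, Complex.conj_I, Complex.ofReal_sub, map_ofNat]
  ring

variable [FiniteDimensional ℝ V] [MeasurableSpace V] [BorelSpace V]

lemma integrable_exp_neg_mul_norm_sq {b : ℝ} (hb : 0 < b) :
    Integrable (fun v : V => Real.exp (-b * ‖v‖ ^ 2)) := by
  have := GaussianFourier.integrable_cexp_neg_mul_sq_norm_add (V := V) (b := (b : ℂ))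
    (by simpa using hb) 0 0
  refine this.norm.congr (Filter.Eventually.of_forall fun v => ?_)
  simp only [zero_mul, add_zero, Complex.norm_exp]
  norm_cast

lemma integrable_gaussian_mul_exp {b : ℝ} (hb : 0 < b) (z : V) :
    Integrable (fun v : V => (Real.exp (-b * ‖v‖ ^ 2) : ℂ) *
      Complex.exp (2 * Real.pi * Complex.I * (⟪z, v⟫ : ℝ))) := by
  have := GaussianFourier.integrable_cexp_neg_mul_sq_norm_add (V := V) (b := (b : ℂ))
    (by simpa using hb) (2 * Real.pi * Complex.I) z
  refine this.congr (Filter.Eventually.of_forall fun v => ?_)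
  simp only [Complex.exp_add]
  push_cast
  rfl

lemma integral_gaussian_mul_exp {b : ℝ} (hb : 0 < b) (z : V) :
    ∫ v : V, (Real.exp (-b * ‖v‖ ^ 2) : ℂ) *
      Complex.exp (2 * Real.pi * Complex.I * (⟪z, v⟫ : ℝ)) =
    (((Real.pi / b) ^ (Module.finrank ℝ V / 2 : ℝ) *
      Real.exp (-(Real.pi ^ 2 * ‖z‖ ^ 2 / b)) : ℝ) : ℂ) := by
  have := GaussianFourier.integral_cexp_neg_mul_sq_norm_add (V := V) (b := (b : ℂ))
    (by simpa using hb) (2 * Real.pi * Complex.I) z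
  have h2 : (fun v : V => (Real.exp (-b * ‖v‖ ^ 2) : ℂ) *
      Complex.exp (2 * Real.pi * Complex.I * (⟪z, v⟫ : ℝ))) =
      fun v : V => Complex.exp (-b * ‖v‖ ^ 2 + 2 * Real.pi * Complex.I * ⟪z, v⟫) := by
    ext v
    simp only [Complex.exp_add]
    push_cast
    rfl
  rw [h2, this]
  push_cast
  rw [Complex.ofReal_cpow (by positivity)]
  push_cast
  congr 2
  have : (b : ℂ) ≠ 0 := by exact_mod_cast hb.ne'
  field_simp
  rw [Complex.I_sq]
  ring

/-- The Gaussian average of `|trigSum|²` is a Gaussian energy of the weighted points. -/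
lemma lintegral_gaussian_trigSum {b : ℝ} (hb : 0 < b) (w : ι → ℝ) (y : ι → V) :
    ∫⁻ ξ : V, ENNReal.ofReal (Real.exp (-b * ‖ξ‖ ^ 2) * ‖trigSum w y ξ‖ ^ 2) =
    ENNReal.ofReal ((Real.pi / b) ^ (Module.finrank ℝ V / 2 : ℝ) *
      ∑ a, ∑ c, w a * w c * Real.exp (-(Real.pi ^ 2 * ‖y a - y c‖ ^ 2 / b))) := by
  have hint : Integrable (fun ξ : V => Real.exp (-b * ‖ξ‖ ^ 2) * ‖trigSum w y ξ‖ ^ 2) := by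
    refine (integrable_exp_neg_mul_norm_sq hb).mul_bdd (c := (∑ a, |w a|) ^ 2)
      (by fun_prop) (Filter.Eventually.of_forall fun ξ => ?_)
    rw [Real.norm_of_nonneg (by positivity)]
    gcongr
    exact norm_trigSum_le w y ξ
  rw [← ofReal_integral_eq_lintegral_ofReal hint
    (Filter.Eventually.of_forall fun ξ => by positivity)]
  congr 1
  rw [← Complex.ofReal_inj, ← integral_complex_ofReal]
  have h : ∀ ξ : V, ((Real.exp (-b * ‖ξ‖ ^ 2) * ‖trigSum w y ξ‖ ^ 2 : ℝ) : ℂ) =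
      ∑ a, ∑ c, ((w a * w c : ℝ) : ℂ) * ((Real.exp (-b * ‖ξ‖ ^ 2) : ℂ) *
      Complex.exp (2 * Real.pi * Complex.I * (⟪y a - y c, ξ⟫ : ℝ))) := by
    intro ξ
    rw [Complex.ofReal_mul, norm_trigSum_sq, Finset.mul_sum]
    refine Finset.sum_congr rfl fun a _ => ?_
    rw [Finset.mul_sum]
    exact Finset.sum_congr rfl fun c _ => by ring
  simp_rw [h]
  rw [integral_finsetSum _ fun a _ => integrable_finsetSum _ fun c _ =>
    (integrable_gaussian_mul_exp hb _).const_mul _]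
  rw [Finset.mul_sum, Complex.ofReal_sum]
  refine Finset.sum_congr rfl fun a _ => ?_
  rw [integral_finsetSum _ fun c _ => (integrable_gaussian_mul_exp hb _).const_mul _,
    Finset.mul_sum, Complex.ofReal_sum]
  refine Finset.sum_congr rfl fun c _ => ?_
  rw [integral_const_mul, integral_gaussian_mul_exp hb, ← Complex.ofReal_mul]
  congr 1
  ring

/-- Convolution with the Gaussian multiplies the coefficient at `y a` by exp(-π‖y a‖²); the modified
weights cancel this factor in advance. -/
lemma trigSum_eq_integral (w : ι → ℝ) (y : ι → V) (ζ : V) :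
    trigSum w y ζ = ∫ η : V, (Real.exp (-Real.pi * ‖η - ζ‖ ^ 2) : ℂ) *
      trigSum (fun a => w a * Real.exp (Real.pi * ‖y a‖ ^ 2)) y η := by
  rw [← integral_add_right_eq_self _ ζ]
  simp_rw [add_sub_cancel_right, trigSum, Finset.mul_sum]
  have h : ∀ (η : V) (a : ι), (Real.exp (-Real.pi * ‖η‖ ^ 2) : ℂ) *
      (((w a * Real.exp (Real.pi * ‖y a‖ ^ 2) : ℝ) : ℂ) *
        Complex.exp (2 * Real.pi * Complex.I * (⟪y a, η + ζ⟫ : ℝ))) =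
      (((w a * Real.exp (Real.pi * ‖y a‖ ^ 2) : ℝ) : ℂ) *
        Complex.exp (2 * Real.pi * Complex.I * (⟪y a, ζ⟫ : ℝ))) *
      ((Real.exp (-Real.pi * ‖η‖ ^ 2) : ℂ) *
        Complex.exp (2 * Real.pi * Complex.I * (⟪y a, η⟫ : ℝ))) := by
    intro η a
    rw [inner_add_right, Complex.ofReal_add, mul_add, Complex.exp_add]
    ring
  simp_rw [h]
  rw [integral_finsetSum _ fun a _ => (integrable_gaussian_mul_exp Real.pi_pos _).const_mul _]
  refine Finset.sum_congr rfl fun a _ => ?_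
  rw [integral_const_mul, integral_gaussian_mul_exp Real.pi_pos, div_self Real.pi_ne_zero,
    Real.one_rpow, one_mul]
  have h1 : Real.exp (Real.pi * ‖y a‖ ^ 2) * Real.exp (-(Real.pi ^ 2 * ‖y a‖ ^ 2 / Real.pi)) = 1 := by
    rw [← Real.exp_add, Real.exp_eq_one_iff]
    have := Real.pi_ne_zero
    field_simp
    ring
  rw [mul_right_comm ((w a * Real.exp (Real.pi * ‖y a‖ ^ 2) : ℝ) : ℂ), ← Complex.ofReal_mul,
    mul_assoc (w a), h1, mul_one]

/-- Jensen's inequality: with c the mean of `F`, integrate 2 Re(c̄ F) ≤ ‖F‖² + ‖c‖² against `g`. -/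
lemma norm_integral_sq_le_of_integral_eq_one {α : Type*} [MeasurableSpace α] {μ : Measure α}
    {g : α → ℝ} {F : α → ℂ} (hg : ∀ x, 0 ≤ g x) (hg1 : ∫ x, g x ∂μ = 1) (hgi : Integrable g μ)
    (hgF : Integrable (fun x => (g x : ℂ) * F x) μ)
    (hgF2 : Integrable (fun x => g x * ‖F x‖ ^ 2) μ) :
    ‖∫ x, (g x : ℂ) * F x ∂μ‖ ^ 2 ≤ ∫ x, g x * ‖F x‖ ^ 2 ∂μ := by
  set c := ∫ x, (g x : ℂ) * F x ∂μ with hc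
  have hre : ∫ x, ((starRingEnd ℂ) c * ((g x : ℂ) * F x)).re ∂μ = ‖c‖ ^ 2 := by
    have h := integral_re (𝕜 := ℂ) (hgF.const_mul ((starRingEnd ℂ) c))
    simp only [RCLike.re_to_complex] at h
    rw [h, integral_const_mul, ← hc, mul_comm, Complex.mul_conj, Complex.ofReal_re,
      Complex.normSq_eq_norm_sq]
  have hrei : Integrable (fun x => ((starRingEnd ℂ) c * ((g x : ℂ) * F x)).re) μ :=
    (hgF.const_mul ((starRingEnd ℂ) c)).re
  have key : ∫ x, (2 * ((starRingEnd ℂ) c * ((g x : ℂ) * F x)).re - ‖c‖ ^ 2 * g x) ∂μ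
      ≤ ∫ x, g x * ‖F x‖ ^ 2 ∂μ := by
    refine integral_mono ((hrei.const_mul 2).sub (hgi.const_mul _)) hgF2 fun x => ?_
    have h1 : 2 * ((starRingEnd ℂ) c * F x).re ≤ ‖F x‖ ^ 2 + ‖c‖ ^ 2 := by
      have h2 : ((starRingEnd ℂ) c * F x).re ≤ ‖c‖ * ‖F x‖ := by
        refine (Complex.re_le_norm _).trans ?_
        rw [norm_mul, Complex.norm_conj]
      nlinarith [sq_nonneg (‖F x‖ - ‖c‖)]
    have h3 : ((starRingEnd ℂ) c * ((g x : ℂ) * F x)).re = g x * ((starRingEnd ℂ) c * F x).re := by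
      rw [mul_left_comm, Complex.re_ofReal_mul]
    simp only [h3]
    nlinarith [mul_le_mul_of_nonneg_left h1 (hg x)]
  rw [integral_sub (hrei.const_mul 2) (hgi.const_mul _), integral_const_mul, integral_const_mul,
    hre, hg1] at key
  linarith

/-- `|trigSum|²` is controlled pointwise by a Gaussian average of a comparable `|trigSum|²`. -/
lemma norm_trigSum_sq_le_lintegral (w : ι → ℝ) (y : ι → V) (ζ : V) :
    ENNReal.ofReal (‖trigSum w y ζ‖ ^ 2) ≤
      ∫⁻ η : V, ENNReal.ofReal (Real.exp (-Real.pi * ‖η - ζ‖ ^ 2)) *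
      ENNReal.ofReal (‖trigSum (fun a => w a * Real.exp (Real.pi * ‖y a‖ ^ 2)) y η‖ ^ 2) := by
  set w' := fun a => w a * Real.exp (Real.pi * ‖y a‖ ^ 2) with hw'
  have hg : Integrable (fun η : V => Real.exp (-Real.pi * ‖η - ζ‖ ^ 2)) :=
    (integrable_exp_neg_mul_norm_sq Real.pi_pos).comp_sub_right ζ
  have hg1 : ∫ η : V, Real.exp (-Real.pi * ‖η - ζ‖ ^ 2) = 1 := by
    rw [integral_sub_right_eq_self (fun η : V => Real.exp (-Real.pi * ‖η‖ ^ 2)) ζ,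
      GaussianFourier.integral_rexp_neg_mul_sq_norm Real.pi_pos, div_self Real.pi_ne_zero,
      Real.one_rpow]
  have hgF : Integrable (fun η : V => (Real.exp (-Real.pi * ‖η - ζ‖ ^ 2) : ℂ) * trigSum w' y η) :=
    hg.ofReal.mul_bdd (c := ∑ a, |w' a|) (by fun_prop)
      (Filter.Eventually.of_forall fun ξ => norm_trigSum_le w' y ξ)
  have hgF2 : Integrable
      (fun η : V => Real.exp (-Real.pi * ‖η - ζ‖ ^ 2) * ‖trigSum w' y η‖ ^ 2) := by
    refine hg.mul_bdd (c := (∑ a, |w' a|) ^ 2)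
      (by fun_prop) (Filter.Eventually.of_forall fun ξ => ?_)
    rw [Real.norm_of_nonneg (by positivity)]
    gcongr
    exact norm_trigSum_le w' y ξ
  have h := norm_integral_sq_le_of_integral_eq_one (fun η => (Real.exp_pos _).le) hg1 hg hgF hgF2
  rw [← trigSum_eq_integral] at h
  refine (ENNReal.ofReal_le_ofReal h).trans ?_
  rw [ofReal_integral_eq_lintegral_ofReal hgF2
    (Filter.Eventually.of_forall fun ξ => by positivity)]
  exact (lintegral_congr fun η => ENNReal.ofReal_mul (Real.exp_pos _).le).le

end TrigSum

/-! ### Hausdorff content and discrete Frostman weights. -/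

section Frostman

open Filter Topology Metric

universe u

variable {X : Type u} [MetricSpace X]

/-- A set of nonzero `s`-dimensional Hausdorff measure has positive `s`-dimensional content. -/
lemma exists_pos_le_sum_rpow_of_hausdorffMeasure_ne_zero [MeasurableSpace X] [BorelSpace X]
    {S : Set X} {s : ℝ} (hs : 0 < s) (hS : μH[s] S ≠ 0) :
    ∃ c : ℝ, 0 < c ∧ ∀ (κ : Type u) [Fintype κ] (x : κ → X) (r : κ → ℝ), (∀ i, 0 ≤ r i) →
      S ⊆ ⋃ i, closedBall (x i) (r i) → c ≤ ∑ i, r i ^ s := by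
  by_contra! hcon
  have hcon' : ∀ n : ℕ, ∃ (κ : Type u) (_ : Fintype κ) (x : κ → X) (r : κ → ℝ), (∀ i, 0 ≤ r i) ∧
      S ⊆ ⋃ i, closedBall (x i) (r i) ∧ ∑ i, r i ^ s < 1 / ((n : ℝ) + 1) :=
    fun n => hcon _ (by positivity)
  choose κ hκ x r hr hcov hsum using hcon'
  have hdiam : ∀ n i, ediam (closedBall (x n i) (r n i)) ≤ ENNReal.ofReal (2 * r n i) := by
    intro n i
    refine ediam_le_of_forall_dist_le fun a ha b hb => ?_
    have := dist_triangle_right a b (x n i)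
    rw [mem_closedBall] at ha hb
    linarith
  have hlim : Tendsto (fun n : ℕ => (1 : ℝ) / ((n : ℝ) + 1)) atTop (𝓝 0) :=
    tendsto_one_div_add_atTop_nhds_zero_nat
  -- Each `r n i ^ s` is one term of a sum below 1/(n+1), so all the radii tend to zero with n. The
  -- covers are therefore admissible in the definition of Hausdorff measure, not just of content.
  have hrlim : Tendsto (fun n : ℕ => ENNReal.ofReal (2 * ((1 : ℝ) / ((n : ℝ) + 1)) ^ (1 / s)))
      atTop (𝓝 0) := by
    have h1 := hlim.rpow_const (p := 1 / s) (Or.inr (by positivity))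
    rw [Real.zero_rpow (by positivity)] at h1
    simpa using ENNReal.tendsto_ofReal (h1.const_mul 2)
  have hle := Measure.hausdorffMeasure_le_liminf_sum (ι := κ) s S (l := atTop) _ hrlim
    (fun n i => closedBall (x n i) (r n i))
    (Eventually.of_forall fun n i => by
      refine (hdiam n i).trans (ENNReal.ofReal_le_ofReal ?_)
      gcongr
      rw [one_div s, Real.le_rpow_inv_iff_of_pos (hr n i) (by positivity) hs]
      exact (Finset.single_le_sum (f := fun i => r n i ^ s)
        (fun i _ => Real.rpow_nonneg (hr n i) s) (Finset.mem_univ i)).trans (hsum n).le)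
    (Eventually.of_forall hcov)
  have hup : ∀ n, ∑ i, ediam (closedBall (x n i) (r n i)) ^ s
      ≤ ENNReal.ofReal (2 ^ s * (1 / ((n : ℝ) + 1))) := by
    intro n
    calc ∑ i, ediam (closedBall (x n i) (r n i)) ^ s
        ≤ ∑ i, ENNReal.ofReal (2 ^ s * r n i ^ s) := by
          refine Finset.sum_le_sum fun i _ => ?_
          rw [← Real.mul_rpow (by norm_num) (hr n i),
            ← ENNReal.ofReal_rpow_of_nonneg (by have := hr n i; positivity) hs.le]
          exact ENNReal.rpow_le_rpow (hdiam n i) hs.le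
      _ = ENNReal.ofReal (2 ^ s * ∑ i, r n i ^ s) := by
          rw [Finset.mul_sum, ENNReal.ofReal_sum_of_nonneg]
          intro i _
          have := hr n i
          positivity
      _ ≤ _ := by
          apply ENNReal.ofReal_le_ofReal
          gcongr
          exact (hsum n).le
  have hlim2 : Tendsto (fun n : ℕ => ENNReal.ofReal (2 ^ s * (1 / ((n : ℝ) + 1)))) atTop (𝓝 0) := by
    simpa using ENNReal.tendsto_ofReal (hlim.const_mul (2 ^ s))
  apply hS
  refine le_antisymm (hle.trans ?_) zero_le
  rw [← hlim2.liminf_eq]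
  exact liminf_le_liminf (Eventually.of_forall hup)

/-- A discrete form of Frostman's lemma: a compact set of nonzero `s`-dimensional Hausdorff
measure carries, at every scale `2⁻ᴺ`, weights on finitely many points whose mass in balls
of radius `r ≥ 2⁻ᴺ` is at most `r ^ s` and whose total mass is bounded below. -/
theorem exists_frostman_weights [MeasurableSpace X] [BorelSpace X]
    {S : Set X} (hSc : IsCompact S) {s : ℝ} (hs : 0 < s) (hS : μH[s] S ≠ 0) :
    ∃ c : ℝ, 0 < c ∧ ∀ N : ℕ, ∃ (T : Finset X) (w : T → ℝ), (T : Set X) ⊆ S ∧ (∀ a, 0 ≤ w a) ∧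
      c ≤ ∑ a, w a ∧ ∑ a, w a ≤ 1 ∧ ∀ (a : T) (j : ℕ), j ≤ N →
        ∑ b with dist b a ≤ (1 / 2) ^ j, w b ≤ ((1 / 2 : ℝ) ^ j) ^ s := by
  classical
  obtain ⟨c, hc, hcov⟩ := exists_pos_le_sum_rpow_of_hausdorffMeasure_ne_zero hs hS
  -- The 1 serves the case of full mass. In the other case 5 = 4 + 1: the Vitali enlargement factor
  -- 4 (any number above 3 would do), plus the mesh 2⁻ᴺ of the net, at most one further radius.
  refine ⟨min 1 (c / 5 ^ s), by positivity, fun N => ?_⟩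
  obtain ⟨T₀, hT₀S, hT₀f, hT₀⟩ := hSc.finite_cover_balls (e := (1 / 2 : ℝ) ^ N) (by positivity)
  lift T₀ to Finset X using hT₀f
  -- The weights solve a linear programme: maximise the total mass on a net subject to the ball
  -- conditions at the scales 2⁻ʲ, j ≤ N.
  let P : Set (T₀ → ℝ) := {w | (∀ a, 0 ≤ w a) ∧ ∑ a, w a ≤ 1 ∧ ∀ (a : T₀) (j : ℕ), j ≤ N →
        ∑ b with dist b a ≤ (1 / 2) ^ j, w b ≤ ((1 / 2 : ℝ) ^ j) ^ s}
  have hPclosed : IsClosed P := by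
    simp only [P, Set.ofPred_and, Set.ofPred_forall]
    refine IsClosed.inter (isClosed_iInter fun a => isClosed_le (by fun_prop) (by fun_prop))
      (IsClosed.inter (isClosed_le (by fun_prop) (by fun_prop)) ?_)
    exact isClosed_iInter fun a => isClosed_iInter fun j => isClosed_iInter fun _ =>
      isClosed_le (by fun_prop) (by fun_prop)
  have hPsub : P ⊆ Set.Icc 0 1 := by
    intro w hw
    refine ⟨hw.1, fun a => ?_⟩
    exact (Finset.single_le_sum (f := w) (fun i _ => hw.1 i) (Finset.mem_univ a)).trans hw.2.1
  have hPc : IsCompact P := isCompact_Icc.of_isClosed_subset hPclosed hPsub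
  have hP0 : P.Nonempty := by
    refine ⟨0, fun a => le_rfl, by simp, fun a j _ => ?_⟩
    simp only [Pi.zero_apply, Finset.sum_const_zero]
    positivity
  obtain ⟨w, hwP, hmax⟩ := hPc.exists_isMaxOn hP0
    (f := fun w => ∑ a, w a) (by fun_prop)
  refine ⟨T₀, w, hT₀S, hwP.1, ?_, hwP.2.1, hwP.2.2⟩
  by_cases h1 : ∑ a, w a = 1
  · rw [h1]; exact min_le_left _ _
  have hlt : ∑ a, w a < 1 := lt_of_le_of_ne hwP.2.1 h1
  -- At a maximiser of mass below 1 every net point lies in a ball whose constraint is an equality;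
  -- otherwise a small increase of the weight there would respect all the constraints, of which
  -- there are finitely many.
  have htight : ∀ a : T₀, ∃ (b : T₀) (j : ℕ), j ≤ N ∧ dist a b ≤ (1 / 2) ^ j ∧
      ∑ b' with dist b' b ≤ (1 / 2) ^ j, w b' = ((1 / 2 : ℝ) ^ j) ^ s := by
    intro a
    by_contra! hne
    have hsum : ∀ (F : Finset T₀) (ε : ℝ),
        ∑ b ∈ F, (w + Pi.single a ε : T₀ → ℝ) b = ∑ b ∈ F, w b + if a ∈ F then ε else 0 := by
      intro F ε
      simp only [Pi.add_apply, Finset.sum_add_distrib, Pi.single_apply, Finset.sum_ite_eq']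
    have hev : ∀ᶠ ε : ℝ in 𝓝[>] 0, w + Pi.single a ε ∈ P := by
      have hpos : ∀ᶠ ε : ℝ in 𝓝[>] 0, 0 < ε := eventually_mem_nhdsWithin
      have hsmall : ∀ η : ℝ, 0 < η → ∀ᶠ ε : ℝ in 𝓝[>] 0, ε < η := fun η hη =>
        (eventually_lt_nhds hη).filter_mono nhdsWithin_le_nhds
      have hcon : ∀ᶠ ε : ℝ in 𝓝[>] 0, ∀ (b : T₀), ∀ j ∈ Finset.range (N + 1),
          ∑ b' with dist b' b ≤ (1 / 2) ^ j, (w + Pi.single a ε : T₀ → ℝ) b' ≤ ((1 / 2 : ℝ) ^ j) ^ s := by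
        refine eventually_all.2 fun b => (Finset.eventually_all _).2 fun j hj => ?_
        have hjN : j ≤ N := by simpa [Nat.lt_succ_iff] using hj
        by_cases hd : dist a b ≤ (1 / 2) ^ j
        · have hl := lt_of_le_of_ne (hwP.2.2 b j hjN) (hne b j hjN hd)
          filter_upwards [hsmall _ (sub_pos.2 hl)] with ε hε
          rw [hsum, if_pos (by simpa using hd)]
          linarith
        · refine Eventually.of_forall fun ε => ?_
          rw [hsum, if_neg (by simpa using hd), add_zero]
          exact hwP.2.2 b j hjN
      filter_upwards [hpos, hcon, hsmall _ (sub_pos.2 hlt)] with ε hε hε1 hε2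
      refine ⟨fun b => ?_, ?_, fun b j hj => hε1 b j (by simpa [Nat.lt_succ_iff] using hj)⟩
      · refine add_nonneg (hwP.1 b) ?_
        exact (Pi.single_nonneg.2 hε.le : (0 : T₀ → ℝ) ≤ Pi.single a ε) b
      · rw [hsum, if_pos (Finset.mem_univ _)]
        linarith
    obtain ⟨ε, hεP, hε⟩ := (hev.and (eventually_mem_nhdsWithin (s := Set.Ioi (0 : ℝ)))).exists
    have h := hmax hεP
    simp only [Set.mem_ofPred_eq] at h
    rw [hsum, if_pos (Finset.mem_univ _)] at h
    have : (0 : ℝ) < ε := hε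
    linarith
  -- Disjoint tight balls have total mass ∑ r^s, and their enlargements cover S, so the content
  -- bound limits this sum from below.
  let t : Set (T₀ × Fin (N + 1)) := {p |
    ∑ b' with dist b' p.1 ≤ (1 / 2) ^ (p.2 : ℕ), w b' = ((1 / 2 : ℝ) ^ (p.2 : ℕ)) ^ s}
  obtain ⟨v, hvt, hvd, hv⟩ := Vitali.exists_disjoint_subfamily_covering_enlargement_closedBall t
    (fun p => (p.1 : X)) (fun p => (1 / 2 : ℝ) ^ (p.2 : ℕ)) 1
    (fun p _ => pow_le_one₀ (by norm_num) (by norm_num)) 4 (by norm_num)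
  have hcover : S ⊆ ⋃ i : v, closedBall (i.1.1 : X) (5 * (1 / 2 : ℝ) ^ (i.1.2 : ℕ)) := by
    intro p hp
    obtain ⟨a, ha, hpa⟩ := Set.mem_iUnion₂.1 (hT₀ hp)
    obtain ⟨b, j, hj, hab, htj⟩ := htight ⟨a, ha⟩
    obtain ⟨q, hq, hsub⟩ := hv (b, ⟨j, Nat.lt_succ_of_le hj⟩) htj
    refine Set.mem_iUnion.2 ⟨⟨q, hq⟩, ?_⟩
    have h2 : dist a q.1 ≤ 4 * (1 / 2 : ℝ) ^ (q.2 : ℕ) := hsub hab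
    have h3 : dist p a < (1 / 2 : ℝ) ^ N := hpa
    have h4 : (1 / 2 : ℝ) ^ N ≤ (1 / 2 : ℝ) ^ (q.2 : ℕ) :=
      pow_le_pow_of_le_one (by norm_num) (by norm_num) (Nat.lt_succ_iff.1 q.2.2)
    have h5 := dist_triangle p a q.1
    rw [mem_closedBall]
    simp only
    linarith
  have hc1 := hcov v (fun i => (i.1.1 : X)) (fun i => 5 * (1 / 2 : ℝ) ^ (i.1.2 : ℕ))
    (fun i => by positivity) hcover
  have hle : ∑ i : v, ((1 / 2 : ℝ) ^ (i.1.2 : ℕ)) ^ s ≤ ∑ a, w a := by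
    have hdisj : Set.PairwiseDisjoint (↑(Finset.univ : Finset v))
        (fun i : v => (Finset.univ.filter fun b' : T₀ => dist b' i.1.1 ≤ (1 / 2) ^ (i.1.2 : ℕ))) := by
      intro i _ j _ hij
      have hd := hvd i.2 j.2 (fun h => hij (Subtype.ext h))
      rw [Function.onFun, Finset.disjoint_left]
      intro b hb hb'
      exact Set.disjoint_left.1 hd (Finset.mem_filter.1 hb).2 (Finset.mem_filter.1 hb').2
    calc ∑ i : v, ((1 / 2 : ℝ) ^ (i.1.2 : ℕ)) ^ s
        = ∑ i : v, ∑ b' with dist b' i.1.1 ≤ (1 / 2) ^ (i.1.2 : ℕ), w b' :=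
          Finset.sum_congr rfl fun i _ => (hvt i.2).symm
      _ = ∑ b ∈ Finset.univ.biUnion (fun i : v =>
            (Finset.univ.filter fun b' : T₀ => dist b' i.1.1 ≤ (1 / 2) ^ (i.1.2 : ℕ))), w b :=
          (Finset.sum_biUnion hdisj).symm
      _ ≤ _ := Finset.sum_le_sum_of_subset_of_nonneg (Finset.subset_univ _) fun b _ _ => hwP.1 b
  refine (min_le_right _ _).trans ((div_le_iff₀ (by positivity)).2 (hc1.trans ?_))
  calc ∑ i : v, (5 * (1 / 2 : ℝ) ^ (i.1.2 : ℕ)) ^ s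
      = 5 ^ s * ∑ i : v, ((1 / 2 : ℝ) ^ (i.1.2 : ℕ)) ^ s := by
        rw [Finset.mul_sum]
        exact Finset.sum_congr rfl fun i _ => Real.mul_rpow (by norm_num) (by positivity)
    _ ≤ 5 ^ s * ∑ a, w a := by gcongr
    _ = _ := mul_comm _ _

end Frostman

/-! ### Gaussian energies under a ball condition. -/

section GaussianEnergy

open Filter Topology

/-- The right side is K (4^l)^(-s), and exponential decay in 4^l beats every power. -/
lemma exists_exp_neg_four_pow_le (s : ℝ) :
    ∃ K : ℝ, 1 ≤ K ∧ ∀ l : ℕ, Real.exp (-(4 ^ l / 4)) ≤ K * ((1 / 4 : ℝ) ^ s) ^ l := by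
  have h1 := tendsto_rpow_mul_exp_neg_mul_atTop_nhds_zero s (1 / 4) (by norm_num)
  have h2 : Tendsto (fun l : ℕ => (4 : ℝ) ^ l) atTop atTop :=
    tendsto_pow_atTop_atTop_of_one_lt (by norm_num)
  obtain ⟨K, hK⟩ := (h1.comp h2).bddAbove_range
  refine ⟨max 1 K, le_max_left _ _, fun l => ?_⟩
  have h3 : ((4 : ℝ) ^ l) ^ s * Real.exp (-(1 / 4) * 4 ^ l) ≤ K := hK ⟨l, rfl⟩
  have h4 : ((1 / 4 : ℝ) ^ s) ^ l = (((4 : ℝ) ^ l) ^ s)⁻¹ := by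
    rw [← Real.rpow_natCast, ← Real.rpow_mul (by norm_num), mul_comm s, Real.rpow_mul (by norm_num),
      Real.rpow_natCast, ← Real.inv_rpow (by positivity), one_div, inv_pow]
  rw [h4, ← div_eq_mul_inv, le_div_iff₀ (by positivity), mul_comm]
  refine le_trans (le_of_eq ?_) (h3.trans (le_max_right _ _))
  congr 2
  ring

/-- A Gaussian at scale `2⁻ʲ` is dominated by a rapidly decreasing combination of indicators of
balls of radius between `2⁻ʲ` and `1`. -/
lemma exists_exp_neg_le_sum_indicator (s : ℝ) :
    ∃ K : ℝ, 1 ≤ K ∧ ∀ (j : ℕ) (r : ℝ), 0 ≤ r → Real.exp (-(4 ^ j * r ^ 2)) ≤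
      K * ((∑ l ∈ Finset.range (j + 1), ((1 / 4 : ℝ) ^ s) ^ l *
        if r ≤ (1 / 2) ^ (j - l) then 1 else 0) + ((1 / 4 : ℝ) ^ s) ^ j) := by
  obtain ⟨K, hK1, hK⟩ := exists_exp_neg_four_pow_le s
  refine ⟨K, hK1, fun j r hr => ?_⟩
  set q : ℝ := (1 / 4 : ℝ) ^ s with hq
  have hq0 : 0 < q := by positivity
  have hterm : ∀ l ∈ Finset.range (j + 1), 0 ≤ q ^ l * if r ≤ (1 / 2) ^ (j - l) then (1 : ℝ) else 0 := by
    intro l _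
    split_ifs <;> positivity
  by_cases hex : ∃ l, l ≤ j ∧ r ≤ (1 / 2) ^ (j - l)
  · classical
    obtain ⟨hlj, hlr⟩ := Nat.find_spec hex
    set l := Nat.find hex with hl
    have hone : q ^ l ≤ ∑ l ∈ Finset.range (j + 1), q ^ l * if r ≤ (1 / 2) ^ (j - l) then 1 else 0 := by
      refine le_trans (le_of_eq ?_) (Finset.single_le_sum hterm (Finset.mem_range.2 (Nat.lt_succ_of_le hlj)))
      rw [if_pos hlr, mul_one]
    refine le_trans ?_ (mul_le_mul_of_nonneg_left (hone.trans (le_add_of_nonneg_right (by positivity)))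
      (by linarith))
    rcases Nat.eq_zero_or_pos l with h0 | h0
    · rw [h0, pow_zero, mul_one]
      refine le_trans (Real.exp_le_one_iff.2 ?_) hK1
      have : 0 ≤ (4 : ℝ) ^ j * r ^ 2 := by positivity
      linarith
    · refine le_trans (Real.exp_le_exp.2 (neg_le_neg ?_)) (hK l)
      -- Minimality of `l` puts `r` outside the next smaller ball, so 4^j r² exceeds 4^(l-1) = 4^l /
      -- 4.
      have hnot := Nat.find_min hex (m := l - 1) (by omega)
      have hlt : (1 / 2 : ℝ) ^ (j - (l - 1)) < r := by
        by_contra! hle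
        exact hnot ⟨by omega, hle⟩
      clear_value l
      have h4 : (4 : ℝ) ^ l / 4 = 4 ^ j * ((1 / 2 : ℝ) ^ (j - (l - 1))) ^ 2 := by
        obtain ⟨p, rfl⟩ : ∃ p, l = p + 1 := ⟨l - 1, by omega⟩
        obtain ⟨t, rfl⟩ : ∃ t, j = p + t := ⟨j - p, by omega⟩
        have : p + t - (p + 1 - 1) = t := by omega
        have h2 : (4 : ℝ) ^ t * ((1 / 2 : ℝ) ^ t) ^ 2 = 1 := by
          rw [← pow_mul, mul_comm t 2, pow_mul, ← mul_pow]; norm_num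
        rw [this, pow_add 4 p t, mul_assoc, h2]
        ring
      rw [h4]
      gcongr
  -- Beyond distance 1 no indicator is available, and the separate term `q ^ j` takes over.
  · push Not at hex
    have h1 : 1 < r := by simpa using hex j le_rfl
    have h0 : 0 ≤ ∑ l ∈ Finset.range (j + 1), q ^ l * if r ≤ (1 / 2) ^ (j - l) then (1 : ℝ) else 0 :=
      Finset.sum_nonneg hterm
    refine le_trans ?_ (mul_le_mul_of_nonneg_left (le_add_of_nonneg_left h0) (by linarith))
    refine le_trans (Real.exp_le_exp.2 (neg_le_neg ?_)) (hK j)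
    have : (4 : ℝ) ^ j * 1 ≤ 4 ^ j * r ^ 2 := by gcongr; nlinarith
    have : (0 : ℝ) < 4 ^ j := by positivity
    linarith

/-- Gaussian energies of a family of weights satisfying a ball condition of exponent `s` down to
scale `2⁻ᴺ`; the factor `exp (-π 4ʲ / 4ᴺ)` compensates for the smaller scales. -/
lemma exists_gaussian_energy_le (s : ℝ) (hs : 0 < s) :
    ∃ C : ℝ, 0 < C ∧ ∀ {ι X : Type*} [Fintype ι] [PseudoMetricSpace X] (N : ℕ) (y : ι → X)
      (w : ι → ℝ), (∀ a, 0 ≤ w a) → ∑ a, w a ≤ 1 →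
      (∀ (a : ι) (j : ℕ), j ≤ N →
        ∑ b with dist (y b) (y a) ≤ (1 / 2) ^ j, w b ≤ ((1 / 2 : ℝ) ^ j) ^ s) →
      ∀ j : ℕ, Real.exp (-(Real.pi * (4 ^ j / 4 ^ N))) *
        ∑ a, ∑ b, w a * w b * Real.exp (-(16 * Real.pi * 4 ^ j * dist (y a) (y b) ^ 2)) ≤
        C * ((1 / 2 : ℝ) ^ s) ^ j := by
  obtain ⟨K, hK1, hK⟩ := exists_exp_neg_le_sum_indicator s
  obtain ⟨K', hK1', hK'⟩ := exists_exp_neg_four_pow_le s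
  have hp0 : 0 < (1 / 2 : ℝ) ^ s := by positivity
  have hp1 : (1 / 2 : ℝ) ^ s < 1 := Real.rpow_lt_one (by norm_num) (by norm_num) hs
  -- Decay q = p² per dyadic step is chosen because one factor p^l offsets the growth of the ball
  -- mass p^(i-l), and the other makes the sum over `l` geometric.
  have hqp : (1 / 4 : ℝ) ^ s = (1 / 2 : ℝ) ^ s * (1 / 2 : ℝ) ^ s := by
    rw [← Real.mul_rpow (by norm_num) (by norm_num)]; norm_num
  set p : ℝ := (1 / 2 : ℝ) ^ s with hp
  set q : ℝ := (1 / 4 : ℝ) ^ s with hq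
  have hq0 : 0 < q := by positivity
  have hqle : q ≤ p := by rw [hqp]; nlinarith
  refine ⟨K' * (K * ((1 - p)⁻¹ + 1)), by have := sub_pos.2 hp1; positivity, ?_⟩
  intro ι X _ _ N y w hw hw1 hball j
  have hballp : ∀ (a : ι) (j : ℕ), j ≤ N →
      ∑ b with dist (y b) (y a) ≤ (1 / 2) ^ j, w b ≤ p ^ j := by
    intro a j hj
    refine (hball a j hj).trans (le_of_eq ?_)
    rw [hp, ← Real.rpow_natCast, ← Real.rpow_mul (by norm_num), mul_comm, Real.rpow_mul (by norm_num),
      Real.rpow_natCast]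
  have hsmall : ∀ (i : ℕ), i ≤ N → ∀ a,
      ∑ b, w b * Real.exp (-(4 ^ i * dist (y b) (y a) ^ 2)) ≤ K * ((1 - p)⁻¹ + 1) * p ^ i := by
    intro i hi a
    calc ∑ b, w b * Real.exp (-(4 ^ i * dist (y b) (y a) ^ 2))
        ≤ ∑ b, w b * (K * ((∑ l ∈ Finset.range (i + 1), q ^ l *
        if dist (y b) (y a) ≤ (1 / 2) ^ (i - l) then 1 else 0) + q ^ i)) :=
          Finset.sum_le_sum fun b _ => mul_le_mul_of_nonneg_left (hK i _ dist_nonneg) (hw b)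
      _ = K * ((∑ l ∈ Finset.range (i + 1), q ^ l *
          ∑ b with dist (y b) (y a) ≤ (1 / 2) ^ (i - l), w b) + q ^ i * ∑ b, w b) := by
        simp_rw [Finset.sum_filter, Finset.mul_sum]
        rw [Finset.sum_comm, ← Finset.sum_add_distrib, Finset.mul_sum]
        refine Finset.sum_congr rfl fun b _ => ?_
        rw [mul_left_comm, mul_add, Finset.mul_sum]
        congr 2
        · refine Finset.sum_congr rfl fun l _ => ?_
          split_ifs <;> ring
        · ring
      _ ≤ K * ((∑ l ∈ Finset.range (i + 1), p ^ l * p ^ i) + p ^ i * 1) := by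
        have hK0 : 0 ≤ K := by linarith
        refine mul_le_mul_of_nonneg_left (add_le_add (Finset.sum_le_sum fun l hl => ?_)
          (mul_le_mul (pow_le_pow_left₀ hq0.le hqle i) hw1
            (Finset.sum_nonneg fun b _ => hw b) (by positivity))) hK0
        have hl' : l ≤ i := Nat.lt_succ_iff.1 (Finset.mem_range.1 hl)
        calc q ^ l * ∑ b with dist (y b) (y a) ≤ (1 / 2) ^ (i - l), w b
            ≤ q ^ l * p ^ (i - l) := by
              gcongr
              exact hballp a (i - l) (by omega)
          _ = p ^ l * p ^ i := by
              rw [hqp, mul_pow, mul_assoc, ← pow_add]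
              congr 2
              omega
      _ ≤ K * ((1 - p)⁻¹ * p ^ i + p ^ i * 1) := by
        have hK0 : 0 ≤ K := by linarith
        rw [← Finset.sum_mul]
        gcongr
        rw [← tsum_geometric_of_lt_one hp0.le hp1]
        exact (summable_geometric_of_lt_one hp0.le hp1).sum_le_tsum _ fun l _ => by positivity
      _ = _ := by ring
  have hK0 : 0 ≤ K * ((1 - p)⁻¹ + 1) := by
    have := sub_pos.2 hp1
    have hK0 : 0 ≤ K := by linarith
    positivity
  -- Below scale 2⁻ᴺ the ball condition says nothing, so the Gaussian is widened to scale 2⁻ᴺ; for j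
  -- > N the factor exp(-π 4^(j-N)) makes up for the missing p^(j-N).
  set i := min j N with hi
  have hcomp : ∑ a, ∑ b, w a * w b * Real.exp (-(16 * Real.pi * 4 ^ j * dist (y a) (y b) ^ 2)) ≤
      K * ((1 - p)⁻¹ + 1) * p ^ i := by
    calc ∑ a, ∑ b, w a * w b * Real.exp (-(16 * Real.pi * 4 ^ j * dist (y a) (y b) ^ 2))
        ≤ ∑ a, w a * ∑ b, w b * Real.exp (-(4 ^ i * dist (y b) (y a) ^ 2)) := by
          refine Finset.sum_le_sum fun a _ => ?_
          rw [Finset.mul_sum]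
          refine Finset.sum_le_sum fun b _ => ?_
          rw [mul_assoc, dist_comm]
          have := hw a
          have := hw b
          gcongr
          have h1 : (4 : ℝ) ^ i ≤ 4 ^ j := pow_le_pow_right₀ (by norm_num) (min_le_left _ _)
          have h2 : (0 : ℝ) < 4 ^ j := by positivity
          nlinarith [Real.pi_gt_three]
      _ ≤ ∑ a, w a * (K * ((1 - p)⁻¹ + 1) * p ^ i) := by
          refine Finset.sum_le_sum fun a _ => mul_le_mul_of_nonneg_left ?_ (hw a)
          exact hsmall i (min_le_right _ _) a
      _ = (∑ a, w a) * (K * ((1 - p)⁻¹ + 1) * p ^ i) := by rw [Finset.sum_mul]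
      _ ≤ 1 * (K * ((1 - p)⁻¹ + 1) * p ^ i) := by gcongr
      _ = _ := one_mul _
  have hexp : Real.exp (-(Real.pi * (4 ^ j / 4 ^ N))) * p ^ i ≤ K' * p ^ j := by
    rcases le_total j N with hjN | hjN
    · rw [hi, min_eq_left hjN]
      gcongr
      refine le_trans (Real.exp_le_one_iff.2 ?_) hK1'
      have := Real.pi_pos
      have : 0 ≤ Real.pi * ((4 : ℝ) ^ j / 4 ^ N) := by positivity
      linarith
    · rw [hi, min_eq_right hjN]
      obtain ⟨t, rfl⟩ : ∃ t, j = N + t := ⟨j - N, by omega⟩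
      have h1 : (4 : ℝ) ^ (N + t) / 4 ^ N = 4 ^ t := by
        rw [pow_add]; field_simp
      rw [h1, pow_add, mul_left_comm K', mul_comm]
      gcongr
      calc Real.exp (-(Real.pi * 4 ^ t)) ≤ Real.exp (-(4 ^ t / 4)) := by
            gcongr
            have : (0 : ℝ) < 4 ^ t := by positivity
            nlinarith [Real.pi_gt_three]
        _ ≤ K' * q ^ t := hK' t
        _ ≤ K' * p ^ t := by
            have : 0 ≤ K' := by linarith
            gcongr
  calc _ ≤ Real.exp (-(Real.pi * (4 ^ j / 4 ^ N))) * (K * ((1 - p)⁻¹ + 1) * p ^ i) := by gcongr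
    _ = K * ((1 - p)⁻¹ + 1) * (Real.exp (-(Real.pi * (4 ^ j / 4 ^ N))) * p ^ i) := by ring
    _ ≤ K * ((1 - p)⁻¹ + 1) * (K' * p ^ j) := by gcongr
    _ = _ := by ring

end GaussianEnergy

/-! ### The slicing maps and the averaged kernel. -/

section PlaneEnergy

open scoped RealInnerProductSpace

variable {k m : ℕ}

/-- The point `y_0 + ∑ x_i y_i` of `ℝ^m`, for `y = (y_0, …, y_k)` with rows in `ℝ^m`. -/
def slicePoint (x : EuclideanSpace ℝ (Fin k)) (y : EuclideanSpace ℝ (Fin (k + 1) × Fin m)) :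
    EuclideanSpace ℝ (Fin m) :=
  WithLp.toLp 2 fun j => ∑ i : Fin (k + 1), (Fin.cons 1 x.ofLp : Fin (k + 1) → ℝ) i * y (i, j)

/-- The adjoint `ξ ↦ (ξ, x_1 ξ, …, x_k ξ)` of `slicePoint x`. -/
def dualPoint (x : EuclideanSpace ℝ (Fin k)) (ξ : EuclideanSpace ℝ (Fin m)) :
    EuclideanSpace ℝ (Fin (k + 1) × Fin m) :=
  WithLp.toLp 2 fun p => (Fin.cons 1 x.ofLp : Fin (k + 1) → ℝ) p.1 * ξ p.2

/-- The `i`-th row of a matrix. -/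
def matrixRow (y : EuclideanSpace ℝ (Fin (k + 1) × Fin m)) (i : Fin (k + 1)) :
    EuclideanSpace ℝ (Fin m) :=
  WithLp.toLp 2 fun j => y (i, j)

/-- This identifies the exponential sum of the sliced points at ξ with that of the original points
at `dualPoint x ξ`. -/
lemma inner_slicePoint (x : EuclideanSpace ℝ (Fin k)) (y : EuclideanSpace ℝ (Fin (k + 1) × Fin m))
    (ξ : EuclideanSpace ℝ (Fin m)) : ⟪slicePoint x y, ξ⟫ = ⟪y, dualPoint x ξ⟫ := by
  simp only [slicePoint, dualPoint, PiLp.inner_apply, RCLike.inner_apply, conj_trivial,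
    Fintype.sum_prod_type]
  rw [Finset.sum_comm]
  refine Finset.sum_congr rfl fun j _ => ?_
  rw [Finset.mul_sum]
  exact Finset.sum_congr rfl fun i _ => by ring

lemma continuous_consOne (i : Fin (k + 1)) :
    Continuous fun x : EuclideanSpace ℝ (Fin k) => (Fin.cons 1 x.ofLp : Fin (k + 1) → ℝ) i := by
  refine Fin.cases ?_ (fun i => ?_) i
  · simpa using continuous_const
  · simp only [Fin.cons_succ]; fun_prop

lemma continuous_slicePoint : Continuous fun p : EuclideanSpace ℝ (Fin k) ×
    EuclideanSpace ℝ (Fin (k + 1) × Fin m) => slicePoint p.1 p.2 := by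
  refine (PiLp.continuous_toLp 2 _).comp (continuous_pi fun j => ?_)
  refine continuous_finsetSum _ fun i _ => ?_
  exact ((continuous_consOne i).comp continuous_fst).mul (by fun_prop)

lemma continuous_dualPoint : Continuous fun p : EuclideanSpace ℝ (Fin k) ×
    EuclideanSpace ℝ (Fin m) => dualPoint p.1 p.2 := by
  refine (PiLp.continuous_toLp 2 _).comp (continuous_pi fun j => ?_)
  exact ((continuous_consOne _).comp continuous_fst).mul (by fun_prop)

lemma norm_sq_eq_sum_matrixRow (y : EuclideanSpace ℝ (Fin (k + 1) × Fin m)) :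
    ‖y‖ ^ 2 = ‖matrixRow y 0‖ ^ 2 + ∑ i : Fin k, ‖matrixRow y i.succ‖ ^ 2 := by
  rw [EuclideanSpace.norm_sq_eq, Fintype.sum_prod_type, Fin.sum_univ_succ]
  simp only [EuclideanSpace.norm_sq_eq, matrixRow]

lemma norm_sub_dualPoint_sq (x : EuclideanSpace ℝ (Fin k)) (ξ : EuclideanSpace ℝ (Fin m))
    (η : EuclideanSpace ℝ (Fin (k + 1) × Fin m)) :
    ‖η - dualPoint x ξ‖ ^ 2 = ‖ξ - matrixRow η 0‖ ^ 2 +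
      ∑ i : Fin k, ‖matrixRow η i.succ - x i • ξ‖ ^ 2 := by
  rw [norm_sq_eq_sum_matrixRow, norm_sub_rev ξ]
  congr 3
  ext j
  simp [matrixRow, dualPoint]

/-- Completing the square in `x`. -/
lemma le_norm_sq_add_norm_sub_dualPoint_sq (x : EuclideanSpace ℝ (Fin k))
    (ξ : EuclideanSpace ℝ (Fin m)) (η : EuclideanSpace ℝ (Fin (k + 1) × Fin m)) :
    (1 + ‖ξ‖ ^ 2) * ‖x - WithLp.toLp 2 fun i : Fin k =>
        ⟪matrixRow η i.succ, ξ⟫ / (1 + ‖ξ‖ ^ 2)‖ ^ 2 +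
      ‖ξ - matrixRow η 0‖ ^ 2 / 2 + ‖η‖ ^ 2 / (4 * (1 + ‖ξ‖ ^ 2)) - 1 / 2 ≤
    ‖x‖ ^ 2 + ‖η - dualPoint x ξ‖ ^ 2 := by
  set A := 1 + ‖ξ‖ ^ 2 with hA
  have hA0 : 0 < A := by positivity
  -- The quadratic in `x i` has its minimum at u/A, with value n - u²/A; Cauchy–Schwarz, u² ≤ n‖ξ‖²,
  -- bounds this below by n/A.
  have hrow : ∀ i : Fin k, A * (x i - ⟪matrixRow η i.succ, ξ⟫ / A) ^ 2 +
      ‖matrixRow η i.succ‖ ^ 2 / A ≤ x i ^ 2 + ‖matrixRow η i.succ - x i • ξ‖ ^ 2 := by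
    intro i
    have hcs := real_inner_mul_inner_self_le (matrixRow η i.succ) ξ
    rw [real_inner_self_eq_norm_sq, real_inner_self_eq_norm_sq] at hcs
    rw [norm_sub_sq_real, inner_smul_right, norm_smul, mul_pow, Real.norm_eq_abs, sq_abs]
    set u := ⟪matrixRow η i.succ, ξ⟫
    set n := ‖matrixRow η i.succ‖ ^ 2
    have h1 : A * (x i - u / A) ^ 2 = A * x i ^ 2 - 2 * (x i * u) + u * u / A := by
      field_simp
      ring
    rw [h1]
    have h2 : u * u / A + n / A ≤ n := by
      rw [← add_div, div_le_iff₀ hA0, hA]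
      linarith
    have h3 : A * x i ^ 2 = x i ^ 2 + x i ^ 2 * ‖ξ‖ ^ 2 := by rw [hA]; ring
    linarith
  have hsum := Finset.sum_le_sum fun i (_ : i ∈ Finset.univ) => hrow i
  rw [Finset.sum_add_distrib, Finset.sum_add_distrib, ← Finset.mul_sum, ← Finset.sum_div] at hsum
  -- Row 0 does not involve `x`. Half of ‖ξ - η_0‖² pays for its share of ‖η‖²; the other half is
  -- kept for the integration in ξ.
  have h0 : ‖matrixRow η 0‖ ^ 2 / (4 * A) ≤ ‖ξ - matrixRow η 0‖ ^ 2 / 2 + 1 / 2 := by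
    rw [div_le_iff₀ (by positivity)]
    have h1 : ‖matrixRow η 0‖ ≤ ‖ξ‖ + ‖ξ - matrixRow η 0‖ := by
      have h := norm_sub_le ξ (ξ - matrixRow η 0)
      rwa [sub_sub_cancel] at h
    have h2 : ‖matrixRow η 0‖ ^ 2 ≤ 2 * ‖ξ‖ ^ 2 + 2 * ‖ξ - matrixRow η 0‖ ^ 2 := by
      nlinarith [sq_nonneg (‖ξ‖ - ‖ξ - matrixRow η 0‖), norm_nonneg (matrixRow η 0)]
    have h3 : 0 ≤ ‖ξ - matrixRow η 0‖ ^ 2 * ‖ξ‖ ^ 2 := by positivity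
    rw [hA]
    nlinarith
  have hx : ‖x‖ ^ 2 = ∑ i, x i ^ 2 := by simp [EuclideanSpace.norm_sq_eq]
  have hxu : ‖x - WithLp.toLp 2 fun i : Fin k => ⟪matrixRow η i.succ, ξ⟫ / A‖ ^ 2 =
      ∑ i, (x i - ⟪matrixRow η i.succ, ξ⟫ / A) ^ 2 := by
    simp [EuclideanSpace.norm_sq_eq]
  rw [hxu, hx, norm_sub_dualPoint_sq, norm_sq_eq_sum_matrixRow, add_div]
  have h4 : (∑ i : Fin k, ‖matrixRow η i.succ‖ ^ 2) / (4 * A) ≤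
      (∑ i : Fin k, ‖matrixRow η i.succ‖ ^ 2) / A :=
    div_le_div_of_nonneg_left (Finset.sum_nonneg fun i _ => sq_nonneg _) hA0 (by linarith)
  linarith

lemma lintegral_exp_neg_mul_norm_sub_sq {V : Type*} [NormedAddCommGroup V] [InnerProductSpace ℝ V]
    [FiniteDimensional ℝ V] [MeasurableSpace V] [BorelSpace V] {b : ℝ} (hb : 0 < b) (v : V) :
    ∫⁻ x : V, ENNReal.ofReal (Real.exp (-b * ‖x - v‖ ^ 2)) =
      ENNReal.ofReal ((Real.pi / b) ^ (Module.finrank ℝ V / 2 : ℝ)) := by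
  rw [lintegral_sub_right_eq_self (fun x : V => ENNReal.ofReal (Real.exp (-b * ‖x‖ ^ 2))) v,
    ← ofReal_integral_eq_lintegral_ofReal (integrable_exp_neg_mul_norm_sq hb)
      (Filter.Eventually.of_forall fun x => (Real.exp_pos _).le),
    GaussianFourier.integral_rexp_neg_mul_sq_norm hb]

/-- The dyadic majorant of the averaged Gaussian kernel. -/
noncomputable def dyadicKernel (k N : ℕ) (t : ℝ) : ℝ≥0∞ :=
  ∑' j : ℕ, ENNReal.ofReal ((1 / 2 : ℝ) ^ (j * k) * Real.exp (-(Real.pi * (4 ^ j / 4 ^ N))) *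
    Real.exp (-(Real.pi / (16 * 4 ^ j)) * t))

/-- One term of the series suffices, that with 4^J ≤ A < 4^(J+1). It is used with A = 1 + ‖ξ‖², so
the bound becomes independent of ξ. The factor exp π absorbs the difference between A - 1 and A. -/
lemma rpow_neg_mul_exp_le_dyadicKernel (N : ℕ) {A t : ℝ} (hA : 1 ≤ A) (ht : 0 ≤ t) :
    ENNReal.ofReal ((1 / A) ^ (k / 2 : ℝ) * Real.exp (-(Real.pi * ((A - 1) / 4 ^ N))) *
      Real.exp (-(Real.pi * (t / (4 * A))))) ≤
      ENNReal.ofReal (Real.exp Real.pi) * dyadicKernel k N t := by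
  obtain ⟨J, hJ1, hJ2⟩ := exists_nat_pow_near hA (by norm_num : (1 : ℝ) < 4)
  refine le_trans ?_ (mul_le_mul_right (ENNReal.le_tsum J) _)
  rw [← ENNReal.ofReal_mul (Real.exp_pos _).le]
  apply ENNReal.ofReal_le_ofReal
  have hA0 : 0 < A := by linarith
  have h4 : (0 : ℝ) < 4 ^ J := by positivity
  have e1 : (1 / A) ^ (k / 2 : ℝ) ≤ (1 / 2 : ℝ) ^ (J * k) := by
    calc (1 / A) ^ (k / 2 : ℝ) ≤ (1 / 4 ^ J) ^ (k / 2 : ℝ) := by gcongr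
      _ = (1 / 2 : ℝ) ^ (J * k) := by
        have : (1 / 4 ^ J : ℝ) = ((1 / 2 : ℝ) ^ J) ^ (2 : ℝ) := by
          rw [Real.rpow_two, ← pow_mul, mul_comm, pow_mul, ← one_div_pow]; norm_num
        rw [this, ← Real.rpow_mul (by positivity), pow_mul]
        rw [show (2 * (k / 2 : ℝ)) = (k : ℝ) by ring, Real.rpow_natCast]
  have e2 : Real.exp (-(Real.pi * ((A - 1) / 4 ^ N))) ≤
      Real.exp Real.pi * Real.exp (-(Real.pi * (4 ^ J / 4 ^ N))) := by
    rw [← Real.exp_add, Real.exp_le_exp]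
    have h5 : (1 : ℝ) / 4 ^ N ≤ 1 := by
      rw [div_le_one (by positivity)]; exact one_le_pow₀ (by norm_num)
    have h6 : (4 : ℝ) ^ J / 4 ^ N ≤ A / 4 ^ N := by gcongr
    have h7 : (A - 1) / 4 ^ N = A / 4 ^ N - 1 / 4 ^ N := by ring
    rw [h7]
    nlinarith [Real.pi_pos]
  have e3 : Real.exp (-(Real.pi * (t / (4 * A)))) ≤ Real.exp (-(Real.pi / (16 * 4 ^ J)) * t) := by
    rw [Real.exp_le_exp, neg_mul, neg_le_neg_iff]
    rw [show Real.pi / (16 * 4 ^ J) * t = Real.pi * (t / (16 * 4 ^ J)) by ring]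
    have := Real.pi_pos
    refine mul_le_mul_of_nonneg_left (div_le_div_of_nonneg_left ht (by positivity) ?_) this.le
    rw [pow_succ] at hJ2
    linarith
  calc _ ≤ (1 / 2 : ℝ) ^ (J * k) * (Real.exp Real.pi * Real.exp (-(Real.pi * (4 ^ J / 4 ^ N)))) *
        Real.exp (-(Real.pi / (16 * 4 ^ J)) * t) := by gcongr
    _ = _ := by ring

/-- The gain of k dimensions arises here: after completing the square, the integral in `x` is that
of a Gaussian with rate πA on ℝ^k, which equals A^(-k/2). -/
lemma lintegral_kernel_le (N : ℕ) (ξ : EuclideanSpace ℝ (Fin m))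
    (η : EuclideanSpace ℝ (Fin (k + 1) × Fin m)) :
    ∫⁻ x : EuclideanSpace ℝ (Fin k), ENNReal.ofReal (Real.exp (-Real.pi * ‖x‖ ^ 2) *
      Real.exp (-Real.pi / 4 ^ N * ‖ξ‖ ^ 2) * Real.exp (-Real.pi * ‖η - dualPoint x ξ‖ ^ 2)) ≤
    ENNReal.ofReal (Real.exp (2 * Real.pi)) * dyadicKernel k N (‖η‖ ^ 2) *
      ENNReal.ofReal (Real.exp (-(Real.pi / 2) * ‖ξ - matrixRow η 0‖ ^ 2)) := by
  set A := 1 + ‖ξ‖ ^ 2 with hA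
  have hA1 : 1 ≤ A := by rw [hA]; nlinarith [norm_nonneg ξ]
  have hA0 : 0 < A := by linarith
  set u : EuclideanSpace ℝ (Fin k) :=
    WithLp.toLp 2 fun i : Fin k => ⟪matrixRow η i.succ, ξ⟫ / A with hu
  have hpt : ∀ x : EuclideanSpace ℝ (Fin k), Real.exp (-Real.pi * ‖x‖ ^ 2) *
      Real.exp (-Real.pi / 4 ^ N * ‖ξ‖ ^ 2) * Real.exp (-Real.pi * ‖η - dualPoint x ξ‖ ^ 2) ≤
      (Real.exp Real.pi * Real.exp (-(Real.pi / 2) * ‖ξ - matrixRow η 0‖ ^ 2) *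
        (Real.exp (-(Real.pi * ((A - 1) / 4 ^ N))) * Real.exp (-(Real.pi * (‖η‖ ^ 2 / (4 * A)))))) *
        Real.exp (-(Real.pi * A) * ‖x - u‖ ^ 2) := by
    intro x
    simp only [← Real.exp_add]
    rw [Real.exp_le_exp]
    have h := le_norm_sq_add_norm_sub_dualPoint_sq x ξ η
    rw [← hA, ← hu] at h
    have h2 := mul_le_mul_of_nonneg_left h Real.pi_pos.le
    have h3 : (A - 1) / 4 ^ N = ‖ξ‖ ^ 2 / 4 ^ N := by rw [hA]; ring
    have h4 : -Real.pi / 4 ^ N * ‖ξ‖ ^ 2 = -(Real.pi * (‖ξ‖ ^ 2 / 4 ^ N)) := by ring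
    rw [h3, h4]
    nlinarith [Real.pi_pos]
  refine (lintegral_mono fun x => ENNReal.ofReal_le_ofReal (hpt x)).trans ?_
  simp_rw [ENNReal.ofReal_mul (p := Real.exp Real.pi *
    Real.exp (-(Real.pi / 2) * ‖ξ - matrixRow η 0‖ ^ 2) *
        (Real.exp (-(Real.pi * ((A - 1) / 4 ^ N))) * Real.exp (-(Real.pi * (‖η‖ ^ 2 / (4 * A))))))
        (by positivity)]
  rw [lintegral_const_mul' _ _ ENNReal.ofReal_ne_top,
    lintegral_exp_neg_mul_norm_sub_sq (mul_pos Real.pi_pos hA0), finrank_euclideanSpace,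
    Fintype.card_fin, ← ENNReal.ofReal_mul (by positivity)]
  have hdiv : Real.pi / (Real.pi * A) = 1 / A := by
    have := Real.pi_ne_zero
    field_simp
  rw [hdiv]
  calc _ = ENNReal.ofReal (Real.exp Real.pi) *
        ENNReal.ofReal ((1 / A) ^ (k / 2 : ℝ) * Real.exp (-(Real.pi * ((A - 1) / 4 ^ N))) *
          Real.exp (-(Real.pi * (‖η‖ ^ 2 / (4 * A))))) *
        ENNReal.ofReal (Real.exp (-(Real.pi / 2) * ‖ξ - matrixRow η 0‖ ^ 2)) := by
        rw [← ENNReal.ofReal_mul (by positivity), ← ENNReal.ofReal_mul (by positivity)]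
        congr 1
        ring
    _ ≤ ENNReal.ofReal (Real.exp Real.pi) *
        (ENNReal.ofReal (Real.exp Real.pi) * dyadicKernel k N (‖η‖ ^ 2)) *
        ENNReal.ofReal (Real.exp (-(Real.pi / 2) * ‖ξ - matrixRow η 0‖ ^ 2)) := by
        gcongr
        exact rpow_neg_mul_exp_le_dyadicKernel N hA1 (by positivity)
    _ = _ := by
        rw [← mul_assoc, ← ENNReal.ofReal_mul (by positivity), ← Real.exp_add, ← two_mul]

lemma lintegral_lintegral_kernel_le (N : ℕ) (η : EuclideanSpace ℝ (Fin (k + 1) × Fin m)) :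
    ∫⁻ ξ : EuclideanSpace ℝ (Fin m), ∫⁻ x : EuclideanSpace ℝ (Fin k),
      ENNReal.ofReal (Real.exp (-Real.pi * ‖x‖ ^ 2) *
      Real.exp (-Real.pi / 4 ^ N * ‖ξ‖ ^ 2) * Real.exp (-Real.pi * ‖η - dualPoint x ξ‖ ^ 2)) ≤
    ENNReal.ofReal (Real.exp (2 * Real.pi) * 2 ^ (m / 2 : ℝ)) * dyadicKernel k N (‖η‖ ^ 2) := by
  refine (lintegral_mono fun ξ => lintegral_kernel_le N ξ η).trans ?_
  rw [lintegral_const_mul _ (by fun_prop), lintegral_exp_neg_mul_norm_sub_sq (by positivity),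
    finrank_euclideanSpace, Fintype.card_fin, mul_right_comm, ← ENNReal.ofReal_mul (by positivity)]
  have : Real.pi / (Real.pi / 2) = 2 := by
    have := Real.pi_ne_zero
    field_simp
  rw [this]

end PlaneEnergy

/-! ### Uniform bound for the energy of the slices. -/

section PlaneEnergyBound

open scoped RealInnerProductSpace

variable {k m : ℕ} {ι : Type*} [Fintype ι]

/-- The mean square over `x` of the exponential sums of the slices `slicePoint x ∘ y`. -/
noncomputable def sliceEnergy (N : ℕ) (w : ι → ℝ)
    (y : ι → EuclideanSpace ℝ (Fin (k + 1) × Fin m)) : ℝ≥0∞ :=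
  ∫⁻ x : EuclideanSpace ℝ (Fin k), ∫⁻ ξ : EuclideanSpace ℝ (Fin m),
    ENNReal.ofReal (Real.exp (-Real.pi * ‖x‖ ^ 2) * Real.exp (-Real.pi / 4 ^ N * ‖ξ‖ ^ 2)) *
      ENNReal.ofReal (‖trigSum w y (dualPoint x ξ)‖ ^ 2)

/-- Replace the square at `dualPoint x ξ` by its Gaussian average over η, then use Tonelli to
integrate the kernel first in `x`, next in ξ, with η outermost. -/
lemma sliceEnergy_le_lintegral (N : ℕ) (w : ι → ℝ)
    (y : ι → EuclideanSpace ℝ (Fin (k + 1) × Fin m)) :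
    sliceEnergy N w y ≤ ENNReal.ofReal (Real.exp (2 * Real.pi) * 2 ^ (m / 2 : ℝ)) *
      ∫⁻ η, dyadicKernel k N (‖η‖ ^ 2) *
        ENNReal.ofReal (‖trigSum (fun a => w a * Real.exp (Real.pi * ‖y a‖ ^ 2)) y η‖ ^ 2) := by
  set F := trigSum (fun a => w a * Real.exp (Real.pi * ‖y a‖ ^ 2)) y with hF
  have hFc : Continuous F := continuous_trigSum _ _
  let G : EuclideanSpace ℝ (Fin k) → EuclideanSpace ℝ (Fin m) →
      EuclideanSpace ℝ (Fin (k + 1) × Fin m) → ℝ≥0∞ := fun x ξ η =>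
    ENNReal.ofReal (Real.exp (-Real.pi * ‖x‖ ^ 2) * Real.exp (-Real.pi / 4 ^ N * ‖ξ‖ ^ 2) *
      Real.exp (-Real.pi * ‖η - dualPoint x ξ‖ ^ 2)) * ENNReal.ofReal (‖F η‖ ^ 2)
  have hd : Continuous fun p : (EuclideanSpace ℝ (Fin k) × EuclideanSpace ℝ (Fin (k + 1) × Fin m)) ×
      EuclideanSpace ℝ (Fin m) => dualPoint p.1.1 p.2 :=
    continuous_dualPoint.comp (f := fun p : (EuclideanSpace ℝ (Fin k) ×
      EuclideanSpace ℝ (Fin (k + 1) × Fin m)) × EuclideanSpace ℝ (Fin m) => (p.1.1, p.2))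
      (by fun_prop)
  have hG : Measurable fun p : (EuclideanSpace ℝ (Fin k) ×
      EuclideanSpace ℝ (Fin (k + 1) × Fin m)) × EuclideanSpace ℝ (Fin m) =>
      G p.1.1 p.2 p.1.2 := by
    have h1 : Continuous fun p : (EuclideanSpace ℝ (Fin k) ×
        EuclideanSpace ℝ (Fin (k + 1) × Fin m)) × EuclideanSpace ℝ (Fin m) =>
        Real.exp (-Real.pi * ‖p.1.1‖ ^ 2) * Real.exp (-Real.pi / 4 ^ N * ‖p.2‖ ^ 2) *
          Real.exp (-Real.pi * ‖p.1.2 - dualPoint p.1.1 p.2‖ ^ 2) := by fun_prop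
    have h2 : Continuous fun p : (EuclideanSpace ℝ (Fin k) ×
        EuclideanSpace ℝ (Fin (k + 1) × Fin m)) × EuclideanSpace ℝ (Fin m) =>
        ‖F p.1.2‖ ^ 2 := by fun_prop
    exact h1.measurable.ennreal_ofReal.mul h2.measurable.ennreal_ofReal
  calc sliceEnergy N w y ≤ ∫⁻ x, ∫⁻ ξ, ∫⁻ η, G x ξ η := by
        refine lintegral_mono fun x => lintegral_mono fun ξ => ?_
        refine (mul_le_mul_right (norm_trigSum_sq_le_lintegral w y (dualPoint x ξ)) _).trans ?_
        rw [← lintegral_const_mul' _ _ ENNReal.ofReal_ne_top]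
        refine lintegral_mono fun η => le_of_eq ?_
        simp only [G]
        rw [← mul_assoc, ← ENNReal.ofReal_mul (by positivity)]
    _ = ∫⁻ x, ∫⁻ η, ∫⁻ ξ, G x ξ η := by
        refine lintegral_congr fun x => lintegral_lintegral_swap (Measurable.aemeasurable ?_)
        exact hG.comp (f := fun p : EuclideanSpace ℝ (Fin m) ×
          EuclideanSpace ℝ (Fin (k + 1) × Fin m) => ((x, p.2), p.1)) (by fun_prop)
    _ = ∫⁻ η, ∫⁻ x, ∫⁻ ξ, G x ξ η :=
        lintegral_lintegral_swap hG.lintegral_prod_right'.aemeasurable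
    _ = ∫⁻ η, ∫⁻ ξ, ∫⁻ x, G x ξ η := by
        refine lintegral_congr fun η => lintegral_lintegral_swap (Measurable.aemeasurable ?_)
        exact hG.comp (f := fun p : EuclideanSpace ℝ (Fin k) × EuclideanSpace ℝ (Fin m) =>
          ((p.1, η), p.2)) (by fun_prop)
    _ ≤ ∫⁻ η, ENNReal.ofReal (Real.exp (2 * Real.pi) * 2 ^ (m / 2 : ℝ)) *
          (dyadicKernel k N (‖η‖ ^ 2) * ENNReal.ofReal (‖F η‖ ^ 2)) := by
        refine lintegral_mono fun η => ?_
        simp only [G]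
        simp_rw [lintegral_mul_const' _ _ ENNReal.ofReal_ne_top]
        rw [← mul_assoc]
        exact mul_le_mul_left (lintegral_lintegral_kernel_le N η) _
    _ = _ := lintegral_const_mul' _ _ ENNReal.ofReal_ne_top

/-- Each term of the kernel is a Gaussian of width about 2^j in frequency, so it yields an energy at
spatial scale 2⁻ʲ with volume factor (16·4^j)^(n/2) = 4^n 2^(jn), n = (k+1)m. -/
lemma lintegral_dyadicKernel_mul_trigSum (N : ℕ) (w : ι → ℝ)
    (y : ι → EuclideanSpace ℝ (Fin (k + 1) × Fin m)) :
    ∫⁻ η, dyadicKernel k N (‖η‖ ^ 2) * ENNReal.ofReal (‖trigSum w y η‖ ^ 2) =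
    ∑' j : ℕ, ENNReal.ofReal ((1 / 2 : ℝ) ^ (j * k) * Real.exp (-(Real.pi * (4 ^ j / 4 ^ N))) *
      ((4 ^ ((k + 1) * m) * 2 ^ (j * ((k + 1) * m))) *
        ∑ a, ∑ c, w a * w c * Real.exp (-(16 * Real.pi * 4 ^ j * ‖y a - y c‖ ^ 2)))) := by
  simp_rw [dyadicKernel, ← ENNReal.tsum_mul_right]
  rw [lintegral_tsum fun j => by
    refine Continuous.aemeasurable ?_
    simp_rw [← ENNReal.ofReal_mul (p := (1 / 2 : ℝ) ^ (j * k) *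
      Real.exp (-(Real.pi * (4 ^ j / 4 ^ N))) * Real.exp _) (by positivity)]
    exact ENNReal.continuous_ofReal.comp (by fun_prop)]
  refine tsum_congr fun j => ?_
  have hb : 0 < Real.pi / (16 * 4 ^ j) := by positivity
  calc _ = ∫⁻ η : EuclideanSpace ℝ (Fin (k + 1) × Fin m), ENNReal.ofReal ((1 / 2 : ℝ) ^ (j * k) *
          Real.exp (-(Real.pi * (4 ^ j / 4 ^ N)))) *
        ENNReal.ofReal (Real.exp (-(Real.pi / (16 * 4 ^ j)) * ‖η‖ ^ 2) * ‖trigSum w y η‖ ^ 2) := by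
        refine lintegral_congr fun η => ?_
        rw [← ENNReal.ofReal_mul (by positivity), ← ENNReal.ofReal_mul (by positivity), mul_assoc,
          mul_assoc]
    _ = _ := by
        rw [lintegral_const_mul' _ _ ENNReal.ofReal_ne_top, lintegral_gaussian_trigSum hb,
          ← ENNReal.ofReal_mul (by positivity), finrank_euclideanSpace]
        have h1 : Real.pi / (Real.pi / (16 * 4 ^ j)) = 16 * 4 ^ j := by
          have := Real.pi_ne_zero
          field_simp
        have h2 : (16 * 4 ^ j : ℝ) = (4 * 2 ^ j) ^ (2 : ℝ) := by
          rw [Real.rpow_two, mul_pow, ← pow_mul, mul_comm j, pow_mul]; norm_num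
        have h3 : (16 * 4 ^ j : ℝ) ^ ((Fintype.card (Fin (k + 1) × Fin m) : ℝ) / 2) =
            4 ^ ((k + 1) * m) * 2 ^ (j * ((k + 1) * m)) := by
          rw [h2, ← Real.rpow_mul (by positivity), mul_div_cancel₀ _ (by norm_num),
            Real.rpow_natCast, Fintype.card_prod, Fintype.card_fin, Fintype.card_fin, mul_pow,
            ← pow_mul]
        have h4 : ∀ z : ℝ, Real.pi ^ 2 * z / (Real.pi / (16 * 4 ^ j)) = 16 * Real.pi * 4 ^ j * z := by
          intro z
          have := Real.pi_ne_zero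
          field_simp
        rw [h1, h3]
        simp_rw [h4]

/-- The energy of the slices is bounded uniformly in the scale for weights satisfying a ball
condition of exponent `s > (k + 1) m - k`. -/
theorem exists_sliceEnergy_le (k m : ℕ) {s : ℝ} (hs : 0 < s) (hsk : ((k + 1) * m : ℕ) < s + k)
    (R : ℝ) : ∃ C : ℝ, 0 < C ∧ ∀ {ι : Type*} [Fintype ι] (N : ℕ)
      (y : ι → EuclideanSpace ℝ (Fin (k + 1) × Fin m)) (w : ι → ℝ), (∀ a, 0 ≤ w a) →
      ∑ a, w a ≤ 1 → (∀ a, ‖y a‖ ≤ R) →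
      (∀ (a : ι) (j : ℕ), j ≤ N →
        ∑ b with dist (y b) (y a) ≤ (1 / 2) ^ j, w b ≤ ((1 / 2 : ℝ) ^ j) ^ s) →
      sliceEnergy N w y ≤ ENNReal.ofReal C := by
  obtain ⟨C, hC, hball⟩ := exists_gaussian_energy_le s hs
  set n := (k + 1) * m with hn
  -- Ratio of the dyadic series: 2^(-k) from the kernel, 2^n from the frequency volume, 2^(-s) from
  -- the ball condition. Thus ρ = 2^(n-k-s), and ρ < 1 is exactly the dimension hypothesis.
  set ρ : ℝ := (1 / 2 : ℝ) ^ k * 2 ^ n * (1 / 2 : ℝ) ^ s with hρ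
  have hρ0 : 0 < ρ := by positivity
  have hρ1 : ρ < 1 := by
    have : ρ = (2 : ℝ) ^ ((n : ℝ) - k - s) := by
      rw [Real.rpow_sub (by norm_num), Real.rpow_sub (by norm_num), Real.rpow_natCast,
        Real.rpow_natCast, hρ, one_div, Real.inv_rpow (by norm_num), inv_pow]
      field_simp
    rw [this]
    exact Real.rpow_lt_one_of_one_lt_of_neg (by norm_num) (by linarith)
  set C₁ : ℝ := Real.exp (2 * Real.pi) * 2 ^ (m / 2 : ℝ) with hC₁
  set C₂ : ℝ := 4 ^ n * (Real.exp (Real.pi * R ^ 2)) ^ 2 * C with hC₂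
  have h1ρ := sub_pos.2 hρ1
  refine ⟨C₁ * (C₂ * (1 - ρ)⁻¹), by positivity, ?_⟩
  intro ι _ N y w hw hw1 hR hfro
  refine (sliceEnergy_le_lintegral N w y).trans ?_
  rw [lintegral_dyadicKernel_mul_trigSum, ENNReal.ofReal_mul (p := C₁) (by positivity)]
  refine mul_le_mul' le_rfl ?_
  rw [← tsum_geometric_of_lt_one hρ0.le hρ1, ← tsum_mul_left, ENNReal.ofReal_tsum_of_nonneg
    (fun j => by positivity) ((summable_geometric_of_lt_one hρ0.le hρ1).mul_left _)]
  refine ENNReal.tsum_le_tsum fun j => ENNReal.ofReal_le_ofReal ?_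
  have hsum : ∑ a, ∑ c, w a * Real.exp (Real.pi * ‖y a‖ ^ 2) *
        (w c * Real.exp (Real.pi * ‖y c‖ ^ 2)) *
        Real.exp (-(16 * Real.pi * 4 ^ j * ‖y a - y c‖ ^ 2)) ≤
      (Real.exp (Real.pi * R ^ 2)) ^ 2 * ∑ a, ∑ c, w a * w c *
        Real.exp (-(16 * Real.pi * 4 ^ j * dist (y a) (y c) ^ 2)) := by
    simp_rw [Finset.mul_sum]
    refine Finset.sum_le_sum fun a _ => Finset.sum_le_sum fun c _ => ?_
    rw [dist_eq_norm, ← mul_assoc (Real.exp (Real.pi * R ^ 2) ^ 2)]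
    refine mul_le_mul_of_nonneg_right ?_ (Real.exp_pos _).le
    have ha := hw a
    have hc := hw c
    calc _ ≤ w a * Real.exp (Real.pi * R ^ 2) * (w c * Real.exp (Real.pi * R ^ 2)) := by
          gcongr
          · exact hR a
          · exact hR c
      _ = _ := by ring
  have hpow : (1 / 2 : ℝ) ^ (j * k) * 2 ^ (j * n) * ((1 / 2 : ℝ) ^ s) ^ j = ρ ^ j := by
    rw [hρ, mul_pow, mul_pow, ← pow_mul, ← pow_mul, mul_comm j k, mul_comm j n]
  calc _ ≤ (1 / 2 : ℝ) ^ (j * k) * Real.exp (-(Real.pi * (4 ^ j / 4 ^ N))) *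
      ((4 ^ n * 2 ^ (j * n)) * ((Real.exp (Real.pi * R ^ 2)) ^ 2 * ∑ a, ∑ c, w a * w c *
        Real.exp (-(16 * Real.pi * 4 ^ j * dist (y a) (y c) ^ 2)))) := by gcongr
    _ = (1 / 2 : ℝ) ^ (j * k) * 2 ^ (j * n) * (4 ^ n * (Real.exp (Real.pi * R ^ 2)) ^ 2) *
      (Real.exp (-(Real.pi * (4 ^ j / 4 ^ N))) * ∑ a, ∑ c, w a * w c *
        Real.exp (-(16 * Real.pi * 4 ^ j * dist (y a) (y c) ^ 2))) := by ring
    _ ≤ (1 / 2 : ℝ) ^ (j * k) * 2 ^ (j * n) * (4 ^ n * (Real.exp (Real.pi * R ^ 2)) ^ 2) *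
      (C * ((1 / 2 : ℝ) ^ s) ^ j) :=
        mul_le_mul_of_nonneg_left (hball N y w hw hw1 hfro j) (by positivity)
    _ = C₂ * ((1 / 2 : ℝ) ^ (j * k) * 2 ^ (j * n) * ((1 / 2 : ℝ) ^ s) ^ j) := by rw [hC₂]; ring
    _ = C₂ * ρ ^ j := by rw [hpow]

/-- The energy of the slices as a Gaussian energy of the sliced points. -/
lemma sliceEnergy_eq (N : ℕ) (w : ι → ℝ) (y : ι → EuclideanSpace ℝ (Fin (k + 1) × Fin m)) :
    sliceEnergy N w y = ∫⁻ x : EuclideanSpace ℝ (Fin k),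
      ENNReal.ofReal (Real.exp (-Real.pi * ‖x‖ ^ 2)) * ENNReal.ofReal (2 ^ (N * m) *
        ∑ a, ∑ c, w a * w c *
          Real.exp (-(Real.pi * 4 ^ N * ‖slicePoint x (y a) - slicePoint x (y c)‖ ^ 2))) := by
  have hb : 0 < Real.pi / 4 ^ N := by positivity
  refine lintegral_congr fun x => ?_
  have htrig : ∀ ξ, trigSum w y (dualPoint x ξ) = trigSum w (fun a => slicePoint x (y a)) ξ := by
    intro ξ
    simp only [trigSum, inner_slicePoint]
  have h := lintegral_gaussian_trigSum hb w fun a => slicePoint x (y a)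
  have h1 : Real.pi / (Real.pi / 4 ^ N) = 4 ^ N := by
    have := Real.pi_ne_zero
    field_simp
  have h2 : (4 ^ N : ℝ) = (2 ^ N) ^ (2 : ℝ) := by
    rw [Real.rpow_two, ← pow_mul, mul_comm N, pow_mul]; norm_num
  have h3 : (4 ^ N : ℝ) ^ ((m : ℝ) / 2) = 2 ^ (N * m) := by
    rw [h2, ← Real.rpow_mul (by positivity), mul_div_cancel₀ _ (by norm_num), Real.rpow_natCast,
      ← pow_mul]
  have h4 : ∀ z : ℝ, Real.pi ^ 2 * z / (Real.pi / 4 ^ N) = Real.pi * 4 ^ N * z := by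
    intro z
    have := Real.pi_ne_zero
    field_simp
  rw [finrank_euclideanSpace, Fintype.card_fin, h1, h3] at h
  simp_rw [h4] at h
  rw [← h, ← lintegral_const_mul' _ _ ENNReal.ofReal_ne_top]
  refine lintegral_congr fun ξ => ?_
  rw [htrig, ← ENNReal.ofReal_mul (by positivity), ← ENNReal.ofReal_mul (by positivity), mul_assoc,
    neg_div]

end PlaneEnergyBound

/-! ### Tubes, second moments and positive measure. -/

section Union

open Filter Topology Metric

variable {k m : ℕ}

/-- Either H ≤ t or H ≤ H²/t. Integrated, this takes the place of Cauchy–Schwarz. -/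
lemma ENNReal.le_mul_indicator_add_mul_self {α : Type*} {A : Set α} {H : α → ℝ≥0∞} {a : α}
    (hA : H a ≠ 0 → a ∈ A) {t : ℝ} (ht : 0 < t) :
    H a ≤ ENNReal.ofReal t * A.indicator 1 a + ENNReal.ofReal t⁻¹ * (H a * H a) := by
  rcases eq_or_ne (H a) 0 with h0 | h0
  · rw [h0]; exact zero_le
  rw [Set.indicator_of_mem (hA h0), Pi.one_apply, mul_one]
  rcases le_total (H a) (ENNReal.ofReal t) with h | h
  · exact h.trans le_self_add
  · refine le_trans ?_ le_add_self
    rw [← mul_assoc]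
    refine le_mul_of_one_le_left zero_le ?_
    calc (1 : ℝ≥0∞) = ENNReal.ofReal t⁻¹ * ENNReal.ofReal t := by
          rw [← ENNReal.ofReal_mul (by positivity), inv_mul_cancel₀ ht.ne', ENNReal.ofReal_one]
      _ ≤ _ := by gcongr

/-- The neighbourhood of width `2⁻ᴺ` of the graph of `x ↦ slicePoint x y` over the unit ball. -/
def sliceTube (N : ℕ) (y : EuclideanSpace ℝ (Fin (k + 1) × Fin m)) :
    Set (EuclideanSpace ℝ (Fin k) × EuclideanSpace ℝ (Fin m)) :=
  {p | ‖p.1‖ ≤ 1 ∧ dist p.2 (slicePoint p.1 y) ≤ (1 / 2) ^ N}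

lemma continuous_slicePoint_left (y : EuclideanSpace ℝ (Fin (k + 1) × Fin m)) :
    Continuous fun x : EuclideanSpace ℝ (Fin k) => slicePoint x y :=
  continuous_slicePoint.comp (f := fun x => (x, y)) (by fun_prop)

lemma measurableSet_sliceTube (N : ℕ) (y : EuclideanSpace ℝ (Fin (k + 1) × Fin m)) :
    MeasurableSet (sliceTube N y) := by
  have h := continuous_slicePoint_left y
  have h1 : IsClosed {p : EuclideanSpace ℝ (Fin k) × EuclideanSpace ℝ (Fin m) | ‖p.1‖ ≤ 1} :=
    isClosed_le (by fun_prop) (by fun_prop)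
  have h2 : IsClosed {p : EuclideanSpace ℝ (Fin k) × EuclideanSpace ℝ (Fin m) |
      dist p.2 (slicePoint p.1 y) ≤ (1 / 2) ^ N} :=
    isClosed_le (by fun_prop) (by fun_prop)
  exact (h1.inter h2).measurableSet

lemma volume_closedBall_half_pow (N : ℕ) (v : EuclideanSpace ℝ (Fin m)) :
    ENNReal.ofReal (2 ^ (N * m)) * volume (closedBall v ((1 / 2 : ℝ) ^ N)) =
      volume (closedBall (0 : EuclideanSpace ℝ (Fin m)) 1) := by
  rw [Measure.addHaar_closedBall' volume v (by positivity), finrank_euclideanSpace, Fintype.card_fin,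
    ← mul_assoc, ← ENNReal.ofReal_mul (by positivity), ← pow_mul, ← mul_pow]
  norm_num

lemma volume_sliceTube (N : ℕ) (y : EuclideanSpace ℝ (Fin (k + 1) × Fin m)) :
    ENNReal.ofReal (2 ^ (N * m)) * volume (sliceTube N y) =
      volume (closedBall (0 : EuclideanSpace ℝ (Fin k)) 1) *
      volume (closedBall (0 : EuclideanSpace ℝ (Fin m)) 1) := by
  rw [Measure.volume_eq_prod, Measure.prod_apply (measurableSet_sliceTube N y),
    ← lintegral_const_mul' _ _ ENNReal.ofReal_ne_top]
  have h : ∀ x : EuclideanSpace ℝ (Fin k),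
      ENNReal.ofReal (2 ^ (N * m)) * volume (Prod.mk x ⁻¹' sliceTube N y) =
      (closedBall (0 : EuclideanSpace ℝ (Fin k)) 1).indicator
        (fun _ => volume (closedBall (0 : EuclideanSpace ℝ (Fin m)) 1)) x := by
    intro x
    by_cases hx : ‖x‖ ≤ 1
    · rw [Set.indicator_of_mem (by simpa using hx), ← volume_closedBall_half_pow N (slicePoint x y)]
      congr 2
      ext v
      simp [sliceTube, hx]
    · rw [Set.indicator_of_notMem (by simpa using hx)]
      have : Prod.mk x ⁻¹' sliceTube N y = ∅ := by
        ext v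
        simp [sliceTube, hx]
      rw [this, measure_empty, mul_zero]
  simp_rw [h]
  rw [lintegral_indicator_const measurableSet_closedBall, mul_comm]

/-- The fibres over `x` meet only if the two slice points are within 2·2⁻ᴺ. The Gaussian in their
distance then has exponent at least -4π, and the one in `x`, with ‖x‖ ≤ 1, at least -π: hence
exp(5π). -/
lemma volume_sliceTube_inter_le (N : ℕ) (y z : EuclideanSpace ℝ (Fin (k + 1) × Fin m)) :
    ENNReal.ofReal (2 ^ (N * m)) * volume (sliceTube N y ∩ sliceTube N z) ≤
      volume (closedBall (0 : EuclideanSpace ℝ (Fin m)) 1) * ENNReal.ofReal (Real.exp (5 * Real.pi)) *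
      ∫⁻ x : EuclideanSpace ℝ (Fin k), ENNReal.ofReal (Real.exp (-Real.pi * ‖x‖ ^ 2) *
        Real.exp (-(Real.pi * 4 ^ N * ‖slicePoint x y - slicePoint x z‖ ^ 2))) := by
  rw [Measure.volume_eq_prod, Measure.prod_apply
    ((measurableSet_sliceTube N y).inter (measurableSet_sliceTube N z)),
    ← lintegral_const_mul' _ _ ENNReal.ofReal_ne_top, mul_assoc,
    ← lintegral_const_mul' _ _ ENNReal.ofReal_ne_top,
    ← lintegral_const_mul' _ _ measure_closedBall_lt_top.ne]
  refine lintegral_mono fun x => ?_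
  rcases (Prod.mk x ⁻¹' (sliceTube N y ∩ sliceTube N z)).eq_empty_or_nonempty with he | ⟨v, hv⟩
  · simp only [he, measure_empty, mul_zero]
    exact zero_le
  obtain ⟨⟨hx, hvy⟩, ⟨_, hvz⟩⟩ := hv
  simp only at hx hvy hvz
  calc ENNReal.ofReal (2 ^ (N * m)) * volume (Prod.mk x ⁻¹' (sliceTube N y ∩ sliceTube N z))
      ≤ ENNReal.ofReal (2 ^ (N * m)) * volume (closedBall (slicePoint x y) ((1 / 2 : ℝ) ^ N)) := by
        gcongr
        intro u hu
        exact hu.1.2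
    _ = volume (closedBall (0 : EuclideanSpace ℝ (Fin m)) 1) * 1 := by
        rw [volume_closedBall_half_pow, mul_one]
    _ ≤ _ := by
        gcongr
        rw [← ENNReal.ofReal_mul (Real.exp_pos _).le, ← Real.exp_add, ← Real.exp_add,
          ENNReal.one_le_ofReal, Real.one_le_exp_iff]
        have h1 : ‖slicePoint x y - slicePoint x z‖ ≤ 2 * (1 / 2 : ℝ) ^ N := by
          rw [← dist_eq_norm]
          have := dist_triangle_left (slicePoint x y) (slicePoint x z) v
          linarith
        have h2 : 4 ^ N * ‖slicePoint x y - slicePoint x z‖ ^ 2 ≤ 4 := by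
          calc (4 : ℝ) ^ N * ‖slicePoint x y - slicePoint x z‖ ^ 2
              ≤ 4 ^ N * (2 * (1 / 2 : ℝ) ^ N) ^ 2 := by gcongr
            _ = 4 * (4 * (1 / 2 : ℝ) ^ 2) ^ N := by
              rw [mul_pow (4 : ℝ), ← pow_mul, mul_comm 2 N, pow_mul]; ring
            _ = 4 := by norm_num
        have h3 : ‖x‖ ^ 2 ≤ 1 := pow_le_one₀ (norm_nonneg _) hx
        have := Real.pi_pos
        nlinarith

/-- The part over the unit ball of the union of the graphs of `x ↦ slicePoint x y`, `y ∈ S`. -/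
def sliceUnion (S : Set (EuclideanSpace ℝ (Fin (k + 1) × Fin m))) :
    Set (EuclideanSpace ℝ (Fin k) × EuclideanSpace ℝ (Fin m)) :=
  (fun p : EuclideanSpace ℝ (Fin k) × EuclideanSpace ℝ (Fin (k + 1) × Fin m) =>
    (p.1, slicePoint p.1 p.2)) '' (closedBall 0 1 ×ˢ S)

lemma isCompact_sliceUnion {S : Set (EuclideanSpace ℝ (Fin (k + 1) × Fin m))} (hS : IsCompact S) :
    IsCompact (sliceUnion S) :=
  ((isCompact_closedBall _ _).prod hS).image (continuous_fst.prodMk continuous_slicePoint)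

lemma sliceTube_subset_cthickening {S : Set (EuclideanSpace ℝ (Fin (k + 1) × Fin m))}
    {y : EuclideanSpace ℝ (Fin (k + 1) × Fin m)} (hy : y ∈ S) (N : ℕ) :
    sliceTube N y ⊆ cthickening ((1 / 2) ^ N) (sliceUnion S) := by
  rintro ⟨x, v⟩ ⟨hx, hv⟩
  refine mem_cthickening_of_dist_le _ (x, slicePoint x y) _ _ ⟨(x, y), ⟨by simpa using hx, hy⟩, rfl⟩ ?_
  rw [Prod.dist_eq, dist_self]
  exact max_le (by positivity) hv

/-- A second moment bound: finitely many tubes with controlled slice energy cover a set of large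
measure. -/
lemma mass_le_volume_cthickening_add_sliceEnergy {ι : Type*} [Fintype ι]
    {S : Set (EuclideanSpace ℝ (Fin (k + 1) × Fin m))} (N : ℕ)
    (y : ι → EuclideanSpace ℝ (Fin (k + 1) × Fin m)) (hy : ∀ a, y a ∈ S) (w : ι → ℝ)
    (hw : ∀ a, 0 ≤ w a) {t : ℝ} (ht : 0 < t) :
    ENNReal.ofReal (∑ a, w a) * (volume (closedBall (0 : EuclideanSpace ℝ (Fin k)) 1) *
      volume (closedBall (0 : EuclideanSpace ℝ (Fin m)) 1)) ≤
    ENNReal.ofReal t * volume (cthickening ((1 / 2) ^ N) (sliceUnion S)) +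
      ENNReal.ofReal t⁻¹ * (volume (closedBall (0 : EuclideanSpace ℝ (Fin m)) 1) *
        ENNReal.ofReal (Real.exp (5 * Real.pi)) * sliceEnergy N w y) := by
  set D := ENNReal.ofReal (2 ^ (N * m)) with hD
  set β := volume (closedBall (0 : EuclideanSpace ℝ (Fin m)) 1) with hβ
  -- The factor `D` = 2^(Nm) normalises the tubes to a volume independent of N.
  let H : EuclideanSpace ℝ (Fin k) × EuclideanSpace ℝ (Fin m) → ℝ≥0∞ := fun p =>
    ∑ a, ENNReal.ofReal (w a) * D * (sliceTube N (y a)).indicator 1 p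
  have hind : ∀ a, Measurable ((sliceTube N (y a)).indicator (1 : EuclideanSpace ℝ (Fin k) × EuclideanSpace ℝ (Fin m) → ℝ≥0∞)) := fun a =>
    measurable_one.indicator (measurableSet_sliceTube N (y a))
  have hmass : ∫⁻ p, H p = ENNReal.ofReal (∑ a, w a) *
      (volume (closedBall (0 : EuclideanSpace ℝ (Fin k)) 1) * β) := by
    simp only [H]
    rw [lintegral_finsetSum _ fun a _ => (hind a).const_mul _,
      ENNReal.ofReal_sum_of_nonneg fun a _ => hw a, Finset.sum_mul]
    refine Finset.sum_congr rfl fun a _ => ?_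
    rw [lintegral_const_mul _ (hind a), lintegral_indicator_one (measurableSet_sliceTube N (y a)),
      mul_assoc, volume_sliceTube]
  have hsq : ∀ p, H p * H p = ∑ a, ∑ c, ENNReal.ofReal (w a) * ENNReal.ofReal (w c) * (D * D) *
      (sliceTube N (y a) ∩ sliceTube N (y c)).indicator 1 p := by
    intro p
    simp only [H]
    rw [Finset.sum_mul_sum]
    refine Finset.sum_congr rfl fun a _ => Finset.sum_congr rfl fun c _ => ?_
    rw [Set.inter_indicator_one, Pi.mul_apply]
    ring
  have hind2 : ∀ a c, Measurable
      ((sliceTube N (y a) ∩ sliceTube N (y c)).indicator (1 : EuclideanSpace ℝ (Fin k) × EuclideanSpace ℝ (Fin m) → ℝ≥0∞)) := fun a c =>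
    measurable_one.indicator ((measurableSet_sliceTube N (y a)).inter (measurableSet_sliceTube N (y c)))
  have henergy : ∫⁻ p, H p * H p ≤ β * ENNReal.ofReal (Real.exp (5 * Real.pi)) *
      sliceEnergy N w y := by
    have hI : ∀ a c, Measurable fun x : EuclideanSpace ℝ (Fin k) =>
        ENNReal.ofReal (Real.exp (-Real.pi * ‖x‖ ^ 2) *
        Real.exp (-(Real.pi * 4 ^ N * ‖slicePoint x (y a) - slicePoint x (y c)‖ ^ 2))) := by
      intro a c
      have h1 := continuous_slicePoint_left (y a)
      have h2 := continuous_slicePoint_left (y c)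
      exact (Continuous.measurable (by fun_prop)).ennreal_ofReal
    calc ∫⁻ p, H p * H p = ∑ a, ∑ c, ENNReal.ofReal (w a) * ENNReal.ofReal (w c) * (D * D) *
          volume (sliceTube N (y a) ∩ sliceTube N (y c)) := by
          simp_rw [hsq]
          rw [lintegral_finsetSum _ fun a _ => Finset.measurable_sum _ fun c _ =>
            (hind2 a c).const_mul _]
          refine Finset.sum_congr rfl fun a _ => ?_
          rw [lintegral_finsetSum _ fun c _ => (hind2 a c).const_mul _]
          refine Finset.sum_congr rfl fun c _ => ?_
          rw [lintegral_const_mul _ (hind2 a c), lintegral_indicator_one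
            ((measurableSet_sliceTube N (y a)).inter (measurableSet_sliceTube N (y c)))]
      _ ≤ ∑ a, ∑ c, ENNReal.ofReal (w a) * ENNReal.ofReal (w c) * D *
          (β * ENNReal.ofReal (Real.exp (5 * Real.pi)) *
          ∫⁻ x : EuclideanSpace ℝ (Fin k), ENNReal.ofReal (Real.exp (-Real.pi * ‖x‖ ^ 2) *
        Real.exp (-(Real.pi * 4 ^ N * ‖slicePoint x (y a) - slicePoint x (y c)‖ ^ 2)))) := by
          refine Finset.sum_le_sum fun a _ => Finset.sum_le_sum fun c _ => ?_
          rw [← mul_assoc _ D D, mul_assoc _ D (volume _)]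
          exact mul_le_mul_right (volume_sliceTube_inter_le N (y a) (y c)) _
      _ = β * ENNReal.ofReal (Real.exp (5 * Real.pi)) *
          ∫⁻ x : EuclideanSpace ℝ (Fin k), ∑ a, ∑ c,
          ENNReal.ofReal (w a) * ENNReal.ofReal (w c) * D *
            ENNReal.ofReal (Real.exp (-Real.pi * ‖x‖ ^ 2) *
        Real.exp (-(Real.pi * 4 ^ N * ‖slicePoint x (y a) - slicePoint x (y c)‖ ^ 2))) := by
          rw [lintegral_finsetSum _ fun a _ => Finset.measurable_sum _ fun c _ =>
            (hI a c).const_mul _, Finset.mul_sum]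
          refine Finset.sum_congr rfl fun a _ => ?_
          rw [lintegral_finsetSum _ fun c _ => (hI a c).const_mul _, Finset.mul_sum]
          refine Finset.sum_congr rfl fun c _ => ?_
          rw [lintegral_const_mul _ (hI a c), mul_left_comm]
      _ = _ := by
          rw [sliceEnergy_eq]
          congr 1
          refine lintegral_congr fun x => ?_
          rw [← ENNReal.ofReal_mul (Real.exp_pos _).le, Finset.mul_sum, Finset.mul_sum,
            ENNReal.ofReal_sum_of_nonneg fun a _ => ?_]
          · refine Finset.sum_congr rfl fun a _ => ?_
            have ha := hw a
            rw [Finset.mul_sum, Finset.mul_sum, ENNReal.ofReal_sum_of_nonneg fun c _ => by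
              have hc := hw c
              positivity]
            refine Finset.sum_congr rfl fun c _ => ?_
            have hc := hw c
            rw [hD, ← ENNReal.ofReal_mul ha, ← ENNReal.ofReal_mul (by positivity),
              ← ENNReal.ofReal_mul (by positivity)]
            congr 1
            ring
          · have ha := hw a
            have : 0 ≤ ∑ c, w a * w c *
              Real.exp (-(Real.pi * 4 ^ N * ‖slicePoint x (y a) - slicePoint x (y c)‖ ^ 2)) :=
              Finset.sum_nonneg fun c _ => by
                have hc := hw c
                positivity
            positivity
  have hsupp : ∀ p, H p ≠ 0 → p ∈ cthickening ((1 / 2) ^ N) (sliceUnion S) := by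
    intro p hp
    obtain ⟨a, _, ha⟩ := Finset.exists_ne_zero_of_sum_ne_zero hp
    refine sliceTube_subset_cthickening (hy a) N ?_
    by_contra hnot
    rw [Set.indicator_of_notMem hnot, mul_zero] at ha
    exact ha rfl
  have hHm : Measurable H := Finset.measurable_sum _ fun a _ => (hind a).const_mul _
  have hHH : Measurable fun p => ENNReal.ofReal t⁻¹ * (H p * H p) := (hHm.mul hHm).const_mul _
  rw [← hmass]
  calc ∫⁻ p, H p ≤ ∫⁻ p, (ENNReal.ofReal t *
        (cthickening ((1 / 2) ^ N) (sliceUnion S)).indicator 1 p +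
        ENNReal.ofReal t⁻¹ * (H p * H p)) :=
        lintegral_mono fun p => ENNReal.le_mul_indicator_add_mul_self (hsupp p) ht
    _ = ENNReal.ofReal t * volume (cthickening ((1 / 2) ^ N) (sliceUnion S)) +
        ENNReal.ofReal t⁻¹ * ∫⁻ p, H p * H p := by
        rw [lintegral_add_right _ hHH,
          lintegral_const_mul' _ _ ENNReal.ofReal_ne_top,
          lintegral_const_mul' _ _ ENNReal.ofReal_ne_top,
          lintegral_indicator_one isClosed_cthickening.measurableSet]
    _ ≤ _ := by gcongr

/-- If the compact union were null, the volumes of its thickenings would tend to zero, whereas the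
second moment bound has constants independent of the scale. -/
theorem volume_sliceUnion_pos {S : Set (EuclideanSpace ℝ (Fin (k + 1) × Fin m))}
    (hS : IsCompact S) (hdim : (((k + 1) * m : ℕ) : ℝ≥0∞) - (k : ℝ≥0∞) < dimH S) :
    0 < volume (sliceUnion S) := by
  obtain ⟨s, hs1, hs2⟩ := ENNReal.lt_iff_exists_nnreal_btwn.1 hdim
  have hs0 : 0 < (s : ℝ) := by
    have : (0 : ℝ≥0∞) < s := lt_of_le_of_lt zero_le hs1
    exact_mod_cast this
  -- Subtraction in `ℝ≥0∞` truncates at zero; the additive form follows whether or not it does.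
  have hsk : (((k + 1) * m : ℕ) : ℝ) < s + k := by
    have h1 : (((k + 1) * m : ℕ) : ℝ≥0∞) < s + k := by
      by_contra! hle
      exact absurd hs1 (not_lt.2 (ENNReal.le_sub_of_add_le_right (ENNReal.natCast_ne_top k) hle))
    exact_mod_cast h1
  have hH : μH[(s : ℝ)] S ≠ 0 := by
    rw [hausdorffMeasure_of_lt_dimH hs2]
    exact ENNReal.top_ne_zero
  obtain ⟨c, hc, hfro⟩ := exists_frostman_weights hS hs0 hH
  obtain ⟨R, hR⟩ := hS.isBounded.exists_norm_le
  obtain ⟨C, hC, hE⟩ := exists_sliceEnergy_le k m hs0 hsk R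
  by_contra! hvol
  have hvol0 : volume (sliceUnion S) = 0 := le_antisymm hvol zero_le
  set β := volume (closedBall (0 : EuclideanSpace ℝ (Fin m)) 1) with hβ
  set γ := volume (closedBall (0 : EuclideanSpace ℝ (Fin k)) 1) with hγ
  have hβ0 : 0 < β := measure_closedBall_pos _ _ one_pos
  have hγ0 : 0 < γ := measure_closedBall_pos _ _ one_pos
  have hβt : β ≠ ∞ := measure_closedBall_lt_top.ne
  set Q := β * ENNReal.ofReal (Real.exp (5 * Real.pi)) * ENNReal.ofReal C with hQ
  have hQt : Q ≠ ∞ :=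
    ENNReal.mul_ne_top (ENNReal.mul_ne_top hβt ENNReal.ofReal_ne_top) ENNReal.ofReal_ne_top
  have hbound : ∀ (t : ℝ), 0 < t → ∀ N : ℕ, ENNReal.ofReal c * (γ * β) ≤
      ENNReal.ofReal t * volume (cthickening ((1 / 2) ^ N) (sliceUnion S)) +
        ENNReal.ofReal t⁻¹ * Q := by
    intro t ht N
    obtain ⟨T, w, hTS, hw, hcw, hw1, hball⟩ := hfro N
    refine le_trans ?_ ((mass_le_volume_cthickening_add_sliceEnergy (S := S) N
      (fun a : T => (a : EuclideanSpace ℝ (Fin (k + 1) × Fin m))) (fun a => hTS a.2) w hw ht).trans ?_)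
    · gcongr
    · exact add_le_add le_rfl (mul_le_mul' le_rfl (mul_le_mul' le_rfl
        (hE N _ w hw hw1 (fun a => hR a (hTS a.2)) hball)))
  have hthick : Tendsto (fun N : ℕ => volume (cthickening ((1 / 2 : ℝ) ^ N) (sliceUnion S)))
      atTop (𝓝 0) := by
    rw [← hvol0]
    exact (tendsto_measure_cthickening_of_isCompact (isCompact_sliceUnion hS)).comp
      (tendsto_pow_atTop_nhds_zero_of_lt_one (by norm_num) (by norm_num))
  -- The order of limits matters: N → ∞ with t fixed removes the volume term, then t → ∞ removes the
  -- energy term.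
  have hbound2 : ∀ (t : ℝ), 0 < t → ENNReal.ofReal c * (γ * β) ≤ ENNReal.ofReal t⁻¹ * Q := by
    intro t ht
    have hlim : Tendsto (fun N : ℕ => ENNReal.ofReal t *
        volume (cthickening ((1 / 2 : ℝ) ^ N) (sliceUnion S)) + ENNReal.ofReal t⁻¹ * Q) atTop
        (𝓝 (ENNReal.ofReal t * 0 + ENNReal.ofReal t⁻¹ * Q)) :=
      (ENNReal.Tendsto.const_mul hthick (Or.inr ENNReal.ofReal_ne_top)).add_const _
    rw [mul_zero, zero_add] at hlim
    exact ge_of_tendsto' hlim (hbound t ht)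
  have hlim : Tendsto (fun t : ℝ => ENNReal.ofReal t⁻¹ * Q) atTop (𝓝 (ENNReal.ofReal 0 * Q)) :=
    ENNReal.Tendsto.mul_const (ENNReal.tendsto_ofReal tendsto_inv_atTop_zero) (Or.inr hQt)
  have hfin : ENNReal.ofReal c * (γ * β) ≤ ENNReal.ofReal 0 * Q :=
    ge_of_tendsto hlim ((eventually_gt_atTop 0).mono hbound2)
  rw [ENNReal.ofReal_zero, zero_mul] at hfin
  have hpos : 0 < ENNReal.ofReal c * (γ * β) :=
    ENNReal.mul_pos (ENNReal.ofReal_pos.2 hc).ne' (ENNReal.mul_pos hγ0.ne' hβ0.ne').ne'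
  exact absurd hfin (not_le.2 hpos)

end Union

/-! ### Return to planes in ℝ^d. -/

section Transfer

open Metric

variable {d k : ℕ}

lemma continuous_planePoint :
    Continuous fun p : PlaneParam d k × (Fin k → ℝ) => planePoint p.1 p.2 := by
  refine (PiLp.continuous_toLp 2 _).comp (continuous_pi fun i => ?_)
  split_ifs <;> fun_prop

/-- The union is σ-compact: restricting `x` to the balls of radius n gives compact images. -/
lemma measurableSet_biUnion_kPlane {S : Set (PlaneParam d k)} (hS : IsCompact S) :
    MeasurableSet (⋃ y ∈ S, kPlane y) := by
  have h : ⋃ y ∈ S, kPlane y = ⋃ n : ℕ,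
      (fun p : PlaneParam d k × (Fin k → ℝ) => planePoint p.1 p.2) '' (S ×ˢ closedBall 0 n) := by
    ext p
    simp only [kPlane, Set.mem_iUnion, Set.mem_range, Set.mem_image, Set.mem_prod, Prod.exists]
    constructor
    · rintro ⟨y, hy, x, rfl⟩
      obtain ⟨n, hn⟩ := exists_nat_ge ‖x‖
      exact ⟨n, y, x, ⟨hy, by simpa using hn⟩, rfl⟩
    · rintro ⟨n, y, x, ⟨hy, _⟩, rfl⟩
      exact ⟨y, hy, x, rfl⟩
  rw [h]
  exact MeasurableSet.iUnion fun n =>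
    ((hS.prod (isCompact_closedBall _ _)).image continuous_planePoint).isClosed.measurableSet

/-- The splitting of `ℝ^d` into its first `k` and last `d - k` coordinates. -/
noncomputable def splitCoords (hkd : k < d) :
    EuclideanSpace ℝ (Fin d) ≃ₗᵢ[ℝ]
      WithLp 2 (EuclideanSpace ℝ (Fin k) × EuclideanSpace ℝ (Fin (d - k))) :=
  (LinearIsometryEquiv.piLpCongrLeft 2 ℝ ℝ
    ((finCongr (Nat.add_sub_of_le hkd.le).symm).trans finSumFinEquiv.symm)).trans
    (PiLp.sumPiLpEquivProdLpPiLp 2 fun _ => ℝ)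

lemma splitCoords_planePoint (hkd : k < d) (y : PlaneParam d k) (x : EuclideanSpace ℝ (Fin k)) :
    (splitCoords hkd (planePoint y x.ofLp)).ofLp = (x, slicePoint x y) := by
  refine Prod.ext ?_ ?_
  · ext i
    simp [splitCoords, planePoint, LinearIsometryEquiv.piLpCongrLeft_apply,
      Equiv.piCongrLeft'_apply]
  · ext j
    simp [splitCoords, planePoint, slicePoint, LinearIsometryEquiv.piLpCongrLeft_apply,
      Equiv.piCongrLeft'_apply, Fin.sum_univ_succ]

/-- The product carries the sup metric, so the map is no isometry, but passing from the ℓ² product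
to it preserves volume. -/
lemma measurePreserving_splitCoords (hkd : k < d) :
    MeasurePreserving fun p : EuclideanSpace ℝ (Fin d) => (splitCoords hkd p).ofLp :=
  (WithLp.volume_preserving_ofLp _ _).comp (splitCoords hkd).measurePreserving

lemma preimage_sliceUnion_subset (hkd : k < d) (S : Set (PlaneParam d k)) :
    (fun p : EuclideanSpace ℝ (Fin d) => (splitCoords hkd p).ofLp) ⁻¹' sliceUnion S ⊆
      ⋃ y ∈ S, kPlane y := by
  rintro p ⟨⟨x, y⟩, ⟨_, hy⟩, hxy⟩
  refine Set.mem_iUnion₂.2 ⟨y, hy, x.ofLp, ?_⟩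
  simp only at hxy
  rw [← splitCoords_planePoint hkd] at hxy
  exact (splitCoords hkd).injective (WithLp.ofLp_injective 2 hxy)

end Transfer

theorem theorem3 (d k : ℕ) (hkd : k < d) (S : Set (PlaneParam d k)) (hS : IsCompact S)
    (hdim : (((k + 1) * (d - k) : ℕ) : ℝ≥0∞) - (k : ℝ≥0∞) < dimH S) :
    MeasurableSet (⋃ y ∈ S, kPlane y) ∧
      0 < (volume : Measure (EuclideanSpace ℝ (Fin d))) (⋃ y ∈ S, kPlane y) := by
  refine ⟨measurableSet_biUnion_kPlane hS, ?_⟩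
  refine (volume_sliceUnion_pos hS hdim).trans_le ?_
  rw [← (measurePreserving_splitCoords hkd).measure_preimage
    (isCompact_sliceUnion hS).isClosed.measurableSet.nullMeasurableSet]
  exact measure_mono (preimage_sliceUnion_subset hkd S)
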